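/- Let $R$ be a commutative ring with $1\neq 0$ and $X$ an indeterminate over $R$. Terminology, for a commutative ring $A$. For $a,b\in A$ write $a\sim b$ if $a\mid b$ and $b\mid a$; $a\approx b$ if $a=ub$ for a unit $u$; $a\cong b$ if $a\sim b$ and either $a=b=0$, or $a\ne 0$ and $a=rb$ implies that $r$ is a unit. A nonunit $a$ (possibly $0$) is *irreducible* (an *atom*) (resp. *strongly irreducible*, *very strongly irreducible*) if $a=bc$ implies $a\sim b$ or $a\sim c$ (resp. $a\approx b$ or $a\approx c$; $a\cong b$ or $a\cong c$), and *$m$-irreducible* if $Aa$ is maximal among the proper principal ideals. $A$ is *atomic* (resp. *strongly atomic*, *very strongly atomic*, *$m$-atomic*) if each nonzero nonunit is a finite product of irreducible (resp. strongly irreducible, very strongly irreducible, $m$-irreducible) elements. Two factorizations $a_1\cdots a_n=b_1\cdots b_m$ are *isomorphic* (resp. *strongly isomorphic*, *very strongly isomorphic*) if $n=m$ and, after re-ordering, $a_i\sim b_i$ (resp. $a_i\approx b_i$, $a_i\cong b_i$) for all $i$; they are *homomorphic* (resp. *weakly homomorphic*) if for each $i$ there is a $j$ with $a_i\sim b_j$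 (resp. $a_i\mid b_j$) and for each $j$ there is an $i$ with $b_j\sim a_i$ (resp. $b_j\mid a_i$). * For $\alpha\in\{$atomic, strongly atomic, $m$-atomic, very strongly atomic$\}$ and $\beta\in\{$isomorphic, strongly isomorphic, very strongly isomorphic$\}$, $A$ is an *$(\alpha,\beta)$-unique factorization ring* if $A$ is $\alpha$ and any two factorizations of a nonzero nonunit into irreducible elements of the type used to define $\alpha$ are $\beta$. $A$ is a *UFR* if it is an $(\alpha,\beta)$-unique factorization ring for some $(\alpha,\beta)$. * $A$ is *homomorphic-atomic* if it is atomic and any two factorizations of a nonzero nonunit into irreducibles are homomorphic. * $A$ is *factorial* if every regular nonunit (nonunit that is not a zero divisor) is a finite product of irreducibles and any two factorizations of a regular nonunit into irreducibles are isomorphic. * $A$ is a *weak UFR* if it is atomic and any two factorizations of a nonzero nonunit into irreducibles are weakly homomorphic. * For $r\in A$ put $U(r)=\{s\in A: s(r)=(r)\}$. A *$U$-decomposition* of a nonunit $a$ is $a=a_1\cdots a_k\lceil b_1\cdots b_n\rceil$, meaning that $a=a_1\cdots a_kb_1\cdots b_n$ with all $a_i,b_j$ irreducible, $a_i\in U(b_1\cdots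 b_n)$ for all $i$, and $b_j\notin U(b_1\cdots\widehat{b_j}\cdots b_n)$ for all $j$. $A$ is a *Fletcher UFR* if every nonunit has a $U$-decomposition and, for any two $U$-decompositions $a_1\cdots a_k\lceil b_1\cdots b_n\rceil$, $a'_1\cdots a'_{k'}\lceil b'_1\cdots b'_{n'}\rceil$ of the same nonunit, $n=n'$ and, after re-ordering, $b_i\sim b'_i$ for all $i$. * An *atomic $\mu$-factorization* of a nonunit $a$ is $a=\lambda a_1\cdots a_n$ with $\lambda$ a unit and all $a_i$ irreducible. It is *reduced* if $a\neq\lambda a_1\cdots\widehat{a_i}\cdots a_n$ for every $i$; *strongly reduced* if $a\ne\lambda\prod_{i\in S}a_i$ for every proper subset $S\subsetneq\{1,\dots,n\}$; *$\mu$-reduced* if $a\neq\lambda' a_1\cdots\widehat{a_i}\cdots a_n$ for every $i$ and every unit $\lambda'$; *strongly $\mu$-reduced* if $a\ne\lambda'\prod_{i\in S}a_i$ for every proper subset $S$ and every unit $\lambda'$. $A$ is a *reduced* (resp. *strongly reduced*, *$\mu$-reduced*, *strongly $\mu$-reduced*) *UFR* if $A$ is atomic and for each nonunit $a\in A$ and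 any two reduced (resp. strongly reduced, $\mu$-reduced, strongly $\mu$-reduced) atomic $\mu$-factorizations $a=\lambda_1a_1\cdots a_n=\lambda_2b_1\cdots b_m$ we have $n=m$ and, after re-ordering, $a_i\sim b_i$ for all $i$. Prefixing *weak* to one of these four names means that the uniqueness is required only for nonzero nonunits $a$. **Theorem 5.8.** 1. For $P$ either "UFR" or "homomorphic-atomic", the following are equivalent: (a) $R$ is a UFD; (b) $R[X]$ is $P$; (c) for every nonempty set $\{X_\lambda\}_{\lambda\in\Lambda}$ of indeterminates over $R$, $R[\{X_\lambda\}_{\lambda\in\Lambda}]$ is $P$; (d) for some nonempty set $\{X_\lambda\}_{\lambda\in\Lambda}$ of indeterminates over $R$, $R[\{X_\lambda\}_{\lambda\in\Lambda}]$ is $P$. The same holds with $P$ "$(\alpha,\beta)$-unique factorization ring", for each choice of $(\alpha,\beta)$. 2. For $P$ any one of "factorial", "weak UFR", "Fletcher UFR", "$\mu$-reduced UFR", "strongly $\mu$-reduced UFR", "weak $\mu$-reduced UFR", "weak strongly $\mu$-reduced UFR", the following are equivalent: (a) $R$ is a finite direct product of UFDs (possibly fields); (b), (c), (d) as in 1 for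 this $P$. 3. For $P$ any one of "reduced UFR", "strongly reduced UFR", "weak reduced UFR", "weak strongly reduced UFR", the following are equivalent: (a) $R$ is a UFD, or $R\cong D_1\times\cdots\times D_n$ where each $D_i$ is a UFD whose only unit is $1$; (b), (c), (d) as in 1 for this $P$. -/

import Mathlib

open Polynomial

universe u v

namespace ZeroDivFactorization

section Basic

variable {R : Type u} [CommRing R]

/-! Associate relations. -/

/-- `a ∼ b`: each divides the other, i.e. `Ra = Rb`. -/
def Assoc (a b : R) : Prop := a ∣ b ∧ b ∣ a

/-- `a ≈ b`: equality up to a unit factor. -/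
def StrongAssoc (a b : R) : Prop := ∃ w : Rˣ, a = w * b

/-- `a ≅ b`: `a ∼ b`, and either `a = b = 0`, or `a ≠ 0` and `a = r b` forces `r` to be a unit. -/
def VeryStrongAssoc (a b : R) : Prop :=
  Assoc a b ∧ ((a = 0 ∧ b = 0) ∨ (a ≠ 0 ∧ ∀ r : R, a = r * b → IsUnit r))

/-! Irreducible elements. The element `0` is not excluded. -/

/-- Irreducible elements (atoms). This is weaker than Mathlib's `Irreducible`. -/
def IsAtomElt (a : R) : Prop :=
  ¬ IsUnit a ∧ ∀ b c : R, a = b * c → Assoc a b ∨ Assoc a c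

def IsStrongAtomElt (a : R) : Prop :=
  ¬ IsUnit a ∧ ∀ b c : R, a = b * c → StrongAssoc a b ∨ StrongAssoc a c

def IsVeryStrongAtomElt (a : R) : Prop :=
  ¬ IsUnit a ∧ ∀ b c : R, a = b * c → VeryStrongAssoc a b ∨ VeryStrongAssoc a c

/-- `m`-irreducible: `Ra` is maximal among the proper principal ideals. -/
def IsMAtomElt (a : R) : Prop :=
  Maximal (fun I : Ideal R => I ≠ ⊤ ∧ I.IsPrincipal) (Ideal.span {a})

/-! Factorizations are finite families of factors taken up to order, i.e. multisets. -/

/-- `s` is a factorization of `a` into elements satisfying `P`. -/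
def IsFactorization (P : R → Prop) (a : R) (s : Multiset R) : Prop :=
  (∀ x ∈ s, P x) ∧ a = s.prod

/-- After re-ordering, the factors are pairwise related by `r` (in particular both
factorizations have the same number of factors). -/
def IsomorphicVia (r : R → R → Prop) (s t : Multiset R) : Prop := Multiset.Rel r s t

/-- Each factor on either side is related by `r` to some factor on the other side. -/
def HomomorphicVia (r : R → R → Prop) (s t : Multiset R) : Prop :=
  (∀ x ∈ s, ∃ y ∈ t, r x y) ∧ (∀ y ∈ t, ∃ x ∈ s, r y x)

end Basic

section Rings

variable (R : Type u) [CommRing R]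

/-- Every nonzero nonunit is a finite product of elements satisfying `P`. -/
def IsAtomicFor (P : R → Prop) : Prop :=
  ∀ a : R, a ≠ 0 → ¬ IsUnit a → ∃ s : Multiset R, IsFactorization P a s

/-- Atomic rings. -/
def IsAtomicRing : Prop := IsAtomicFor R IsAtomElt

/-- The four forms of atomicity. -/
inductive AtomType
  | atomic
  | stronglyAtomic
  | mAtomic
  | veryStronglyAtomic

/-- The three forms of isomorphism of factorizations. -/
inductive IsoType
  | isomorphic
  | stronglyIsomorphic
  | veryStronglyIsomorphic

/-- The type of irreducible element attached to a form of atomicity. -/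
def AtomType.IsIrred : AtomType → R → Prop
  | .atomic => IsAtomElt
  | .stronglyAtomic => IsStrongAtomElt
  | .mAtomic => IsMAtomElt
  | .veryStronglyAtomic => IsVeryStrongAtomElt

/-- The associate relation attached to a form of isomorphism. -/
def IsoType.AssocRel : IsoType → R → R → Prop
  | .isomorphic => Assoc
  | .stronglyIsomorphic => StrongAssoc
  | .veryStronglyIsomorphic => VeryStrongAssoc

/-- `(α, β)`-unique factorization rings. -/
def IsUFROfType (α : AtomType) (β : IsoType) : Prop :=
  IsAtomicFor R (α.IsIrred R) ∧
  ∀ a : R, a ≠ 0 → ¬ IsUnit a → ∀ s t : Multiset R,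
    IsFactorization (α.IsIrred R) a s → IsFactorization (α.IsIrred R) a t →
      IsomorphicVia (β.AssocRel R) s t

/-- Unique factorization rings: `(α, β)`-unique factorization rings for some `(α, β)`. -/
def IsUFR : Prop := ∃ (α : AtomType) (β : IsoType), IsUFROfType R α β

/-- Atomic, and any two factorizations of a nonzero nonunit into irreducibles are homomorphic. -/
def IsHomomorphicAtomic : Prop :=
  IsAtomicRing R ∧
  ∀ a : R, a ≠ 0 → ¬ IsUnit a → ∀ s t : Multiset R,
    IsFactorization IsAtomElt a s → IsFactorization IsAtomElt a t → HomomorphicVia Assoc s t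

/-- Factorial rings: regular nonunits have unique factorization into irreducibles. -/
def IsFactorialRing : Prop :=
  (∀ a ∈ nonZeroDivisors R, ¬ IsUnit a → ∃ s : Multiset R, IsFactorization IsAtomElt a s) ∧
  ∀ a ∈ nonZeroDivisors R, ¬ IsUnit a → ∀ s t : Multiset R,
    IsFactorization IsAtomElt a s → IsFactorization IsAtomElt a t → IsomorphicVia Assoc s t

/-- Weak UFRs: atomic, and any two factorizations of a nonzero nonunit into irreducibles are
weakly homomorphic. -/
def IsWeakUFR : Prop :=
  IsAtomicRing R ∧
  ∀ a : R, a ≠ 0 → ¬ IsUnit a → ∀ s t : Multiset R,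
    IsFactorization IsAtomElt a s → IsFactorization IsAtomElt a t →
      HomomorphicVia (fun x y => x ∣ y) s t

variable {R} in
/-- `U(r) = {s | s(r) = (r)}`. -/
def fletcherU (r : R) : Set R := {s | Ideal.span {s * r} = Ideal.span {r}}

variable {R} in
/-- `a = a₁ ⋯ a_k ⌈b₁ ⋯ b_n⌉` is a `U`-decomposition, `p` and `q` being the families of the
`a_i` and of the `b_j`. -/
def IsUDecomposition (a : R) (p q : Multiset R) : Prop :=
  (∀ x ∈ p, IsAtomElt x) ∧ (∀ y ∈ q, IsAtomElt y) ∧ a = p.prod * q.prod ∧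
  (∀ x ∈ p, x ∈ fletcherU q.prod) ∧
  ∀ (y : R) (q' : Multiset R), q = y ::ₘ q' → y ∉ fletcherU q'.prod

/-- Fletcher unique factorization rings. Here `a = 0` is not excluded. -/
def IsFletcherUFR : Prop :=
  (∀ a : R, ¬ IsUnit a → ∃ p q : Multiset R, IsUDecomposition a p q) ∧
  ∀ a : R, ¬ IsUnit a → ∀ p q p' q' : Multiset R,
    IsUDecomposition a p q → IsUDecomposition a p' q' → IsomorphicVia Assoc q q'

/-! Reduced `μ`-factorizations `a = l a₁ ⋯ a_n`, where `l` is a unit and `s` is the family of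
the factors `a_i`. -/

variable {R}

/-- No single factor can be omitted. -/
def IsReducedFact (l : Rˣ) (s : Multiset R) : Prop :=
  ∀ (x : R) (t : Multiset R), s = x ::ₘ t → (l : R) * s.prod ≠ l * t.prod

/-- No nonempty set of factors can be omitted. -/
def IsStronglyReducedFact (l : Rˣ) (s : Multiset R) : Prop :=
  ∀ t : Multiset R, t < s → (l : R) * s.prod ≠ l * t.prod

/-- No single factor can be omitted, even when the unit may be changed. -/
def IsMuReducedFact (l : Rˣ) (s : Multiset R) : Prop :=
  ∀ (x : R) (t : Multiset R), s = x ::ₘ t → ∀ l' : Rˣ, (l : R) * s.prod ≠ l' * t.prod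

/-- No nonempty set of factors can be omitted, even when the unit may be changed. -/
def IsStronglyMuReducedFact (l : Rˣ) (s : Multiset R) : Prop :=
  ∀ t : Multiset R, t < s → ∀ l' : Rˣ, (l : R) * s.prod ≠ l' * t.prod

/-- Any two atomic `μ`-factorizations of `a` with property `Q` agree up to order and
associates. -/
def HasUniqueMuFactorizations (Q : Rˣ → Multiset R → Prop) (a : R) : Prop :=
  ∀ (l₁ l₂ : Rˣ) (s t : Multiset R),
    (∀ x ∈ s, IsAtomElt x) → a = l₁ * s.prod → Q l₁ s →
    (∀ x ∈ t, IsAtomElt x) → a = l₂ * t.prod → Q l₂ t →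
      IsomorphicVia Assoc s t

variable (R)

/-- Common form of the reduced unique factorization rings; `a = 0` is not excluded. -/
def HasUniqueQFactorization (Q : Rˣ → Multiset R → Prop) : Prop :=
  IsAtomicRing R ∧ ∀ a : R, ¬ IsUnit a → HasUniqueMuFactorizations Q a

/-- Common form of the weak reduced unique factorization rings; only `a ≠ 0` is considered. -/
def HasWeakUniqueQFactorization (Q : Rˣ → Multiset R → Prop) : Prop :=
  IsAtomicRing R ∧ ∀ a : R, a ≠ 0 → ¬ IsUnit a → HasUniqueMuFactorizations Q a

def IsMuReducedUFR : Prop := HasUniqueQFactorization R IsMuReducedFact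
def IsStronglyMuReducedUFR : Prop := HasUniqueQFactorization R IsStronglyMuReducedFact
def IsWeakMuReducedUFR : Prop := HasWeakUniqueQFactorization R IsMuReducedFact
def IsWeakStronglyMuReducedUFR : Prop := HasWeakUniqueQFactorization R IsStronglyMuReducedFact

def IsReducedUFR : Prop := HasUniqueQFactorization R IsReducedFact
def IsStronglyReducedUFR : Prop := HasUniqueQFactorization R IsStronglyReducedFact
def IsWeakReducedUFR : Prop := HasWeakUniqueQFactorization R IsReducedFact
def IsWeakStronglyReducedUFR : Prop := HasWeakUniqueQFactorization R IsStronglyReducedFact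

/-- Unique factorization domains (fields included). -/
def IsUFD : Prop := IsDomain R ∧ UniqueFactorizationMonoid R

/-- Finite direct products of UFDs. -/
def IsFiniteProductOfUFDs : Prop :=
  ∃ (n : ℕ) (D : Fin n → Type u) (_ : ∀ i, CommRing (D i)),
    (∀ i, IsUFD (D i)) ∧ Nonempty (R ≃+* ∀ i, D i)

/-- Finite direct products of UFDs whose only unit is `1`. -/
def IsFiniteProductOfUFDsWithTrivialUnits : Prop :=
  ∃ (n : ℕ) (D : Fin n → Type u) (_ : ∀ i, CommRing (D i)),
    (∀ i, IsUFD (D i) ∧ ∀ w : (D i)ˣ, w = 1) ∧ Nonempty (R ≃+* ∀ i, D i)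

end Rings

/-- The equivalence of four conditions: `A`; `B` (a condition on the polynomial ring in one
indeterminate); `C Λ` for every nonempty index set `Λ`; `C Λ` for some nonempty index set `Λ`
(`C Λ` being the condition on the polynomial ring in indeterminates indexed by `Λ`). -/
def FourEquiv (A B : Prop) (C : Type v → Prop) : Prop :=
  List.TFAE [A, B, ∀ Λ : Type v, Nonempty Λ → C Λ, ∃ Λ : Type v, Nonempty Λ ∧ C Λ]

end ZeroDivFactorization

open ZeroDivFactorization

universe w

namespace ZeroDivFactorization

open nonZeroDivisors

/-! For a polynomial ring over `R`, each property in the theorem implies the weak statement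
`HasRegularFactorization`. Indeed all notions of irreducibility agree on regular elements, and
cancellation shows that a regular product of irreducibles has no superfluous factor, in any of the
senses considered.

This weak statement already decomposes `R`. The indeterminate `X` is regular; let `c_k` be the
constant terms of its irreducible factors `f_k`. Their product is `0`, and the product rule at the
origin makes `c_k` comaximal with the product of the others. So `R` is the product of the rings
`R/(c_k)`, and `(c_k)` is the annihilator of an idempotent `e`. If `ab = 0`, then `f_k` divides
`X(X+a+b) = (X+a)(X+b)`, whose irreducible factors are translates of factors of `X`; comparing
constant terms, `c_k` divides `a` or `b`. Applied to `ex` and `ey` with `xy` in `(c_k)`, this makes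
`(c_k)` prime unless it is the unit ideal. The polynomial ring over `R/(c_k)` is then a domain and a
direct factor of the one over `R`, so it inherits unique factorization, and so does `R/(c_k)`.

Conversely, in a finite product of UFDs the atoms are the elements that are zero or prime in one
coordinate and units elsewhere. An atom dividing a product divides a factor, and products without
superfluous factors are unique (`rel_assoc_of_irredundant`). Uniqueness fails only because a zero
coordinate absorbs other factors. With two coordinates, `p = p * p` and `p = p * g` exclude UFRs and
homomorphic-atomic rings, and a unit other than `1` lets an absorbed factor leave a trace, which
defeats the reduced variants. -/

/-- A weak form of unique factorization for the regular elements of a ring. -/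
structure HasRegularFactorization (S : Type*) [CommRing S] : Prop where
  exists_factors : ∀ a ∈ S⁰, ¬ IsUnit a → ∃ s : Multiset S, (∀ x ∈ s, Irreducible x) ∧ s.prod = a
  exists_dvd : ∀ (x : S) (t : Multiset S), Irreducible x → (∀ y ∈ t, Irreducible y) →
    t.prod ∈ S⁰ → x ∣ t.prod → ∃ y ∈ t, x ∣ y

/-! ### Factorization of regular elements -/

section Regular

variable {S : Type*} [CommRing S]

theorem mem_nonZeroDivisors_of_dvd {a b : S} (hb : b ∈ S⁰) (h : a ∣ b) : a ∈ S⁰ := by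
  obtain ⟨c, rfl⟩ := h
  exact (mul_mem_nonZeroDivisors.1 hb).1

theorem irreducible_mul_of_isUnit_right {x d : S} (hx : Irreducible x) (hd : IsUnit d) :
    Irreducible (x * d) :=
  (irreducible_mul_isUnit hd).2 hx

/-- When `x * d = t.prod`, the factorization to compare with `t` is `x` followed by the factors of
`d`. A unit `d` need not be factored: it is merged into `x`. -/
theorem HasRegularFactorization.of_exists_dvd
    (h₁ : ∀ a ∈ S⁰, ¬ IsUnit a → ∃ s : Multiset S, (∀ x ∈ s, Irreducible x) ∧ s.prod = a)
    (h₂ : ∀ s t : Multiset S, (∀ x ∈ s, Irreducible x) → (∀ x ∈ t, Irreducible x) →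
      s.prod = t.prod → t.prod ∈ S⁰ → ¬ IsUnit t.prod → ∀ x ∈ s, ∃ y ∈ t, x ∣ y) :
    HasRegularFactorization S where
  exists_factors := h₁
  exists_dvd := by
    rintro x t hx ht hreg ⟨d, hd⟩
    have hu : ¬ IsUnit t.prod := fun h => hx.not_isUnit (isUnit_of_dvd_unit ⟨d, hd⟩ h)
    by_cases hdu : IsUnit d
    · obtain ⟨y, hy, hxy⟩ := h₂ {x * d} t
        (by simpa using irreducible_mul_of_isUnit_right hx hdu) ht
        (by simpa using hd.symm) hreg hu (x * d) (by simp)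
      exact ⟨y, hy, (Dvd.intro _ rfl).trans hxy⟩
    · obtain ⟨s, hs, rfl⟩ := h₁ d (mem_nonZeroDivisors_of_dvd hreg ⟨x, by rw [hd, mul_comm]⟩) hdu
      refine h₂ (x ::ₘ s) t ?_ ht (by simpa using hd.symm) hreg hu x (by simp)
      simpa using ⟨hx, hs⟩

theorem HasRegularFactorization.of_ringEquiv {S' : Type*} [CommRing S']
    (h : HasRegularFactorization S) (e : S ≃+* S') : HasRegularFactorization S' := by
  have hreg : ∀ a ∈ S'⁰, e.symm a ∈ S⁰ := by
    intro a ha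
    rw [mem_nonZeroDivisors_iff_right] at ha ⊢
    intro x hx
    have := ha (e x) (by rw [← e.apply_symm_apply a, ← map_mul, hx, map_zero])
    simpa using this
  have hirr : ∀ {x : S'}, Irreducible x → Irreducible (e.symm x) := fun hx =>
    (MulEquiv.irreducible_iff e.symm).2 hx
  constructor
  · intro a ha hu
    obtain ⟨s, hs, hp⟩ := h.exists_factors _ (hreg a ha) (by simpa using hu)
    refine ⟨s.map e, ?_, ?_⟩
    · intro x hx
      obtain ⟨y, hy, rfl⟩ := Multiset.mem_map.1 hx
      exact (MulEquiv.irreducible_iff e).2 (hs y hy)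
    · rw [← map_multiset_prod, hp]; simp
  · intro x t hx ht hr hd
    obtain ⟨y, hy, hxy⟩ := h.exists_dvd (e.symm x) (t.map e.symm) (hirr hx)
      (by
        intro y hy
        obtain ⟨z, hz, rfl⟩ := Multiset.mem_map.1 hy
        exact hirr (ht z hz))
      (by rw [← map_multiset_prod]; exact hreg _ hr)
      (by rw [← map_multiset_prod]; exact map_dvd _ hd)
    obtain ⟨z, hz, rfl⟩ := Multiset.mem_map.1 hy
    exact ⟨z, hz, by simpa using map_dvd e hxy⟩

end Regular

/-! ### Passage to a direct factor that is a domain -/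

section Descent

variable {S S' : Type*} [CommRing S] [CommRing S'] [IsDomain S']

/-- A domain that is a direct factor of a ring with weakly unique factorization of regular
elements has unique factorization. -/
theorem HasRegularFactorization.uniqueFactorizationMonoid (h : HasRegularFactorization S)
    (φ : S →+* S') (hφ : Function.Surjective φ) (e : S) (he : e * e = e)
    (hker : ∀ s, φ s = 0 ↔ e * s = 0) : UniqueFactorizationMonoid S' := by
  have hφe : φ e = 1 := by
    have : φ (1 - e) = 0 := (hker _).2 (by rw [mul_sub, he]; ring)
    rw [map_sub, map_one, sub_eq_zero] at this
    exact this.symm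
  have heq : ∀ {s t}, φ s = φ t → e * s = e * t := by
    intro s t hst
    have : e * (s - t) = 0 := (hker _).1 (by rw [map_sub, hst, sub_self])
    linear_combination this
  -- `S` splits as `eS × (1-e)S` with `S'` as first component. `θ` keeps that component and puts `1`
  -- in the other, so it depends only on `φ s` and makes nonzero elements of `S'` regular in `S`.
  let θ : S →* S :=
    { toFun := fun s => e * s + (1 - e)
      map_one' := by ring
      map_mul' := fun s t => by
        linear_combination (1 + s * t - s - t) * (-he) }
  have θ_def : ∀ s, θ s = e * s + (1 - e) := fun _ => rfl
  have hφθ : ∀ s, φ (θ s) = φ s := fun s => by simp [θ_def, hφe]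
  have hθ : ∀ {s t}, φ s = φ t → θ s = θ t := fun hst => by rw [θ_def, θ_def, heq hst]
  have hunit : ∀ s, IsUnit (θ s) ↔ IsUnit (φ s) := by
    intro s
    refine ⟨fun hs => hφθ s ▸ hs.map φ, fun hs => ?_⟩
    obtain ⟨y, hy⟩ := hs.exists_right_inv
    obtain ⟨t, rfl⟩ := hφ y
    refine IsUnit.of_mul_eq_one (θ t) ?_
    rw [← map_mul, ← map_one θ]
    exact hθ (by simpa using hy)
  have hreg : ∀ s, φ s ≠ 0 → θ s ∈ S⁰ := by
    intro s hs
    rw [mem_nonZeroDivisors_iff_right]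
    intro y hy
    have h1 : φ y * φ s = 0 := by rw [← hφθ s, ← map_mul, hy, map_zero]
    have h2 : e * y = 0 := (hker _).1 ((mul_eq_zero.1 h1).resolve_right hs)
    rw [θ_def] at hy
    linear_combination hy + (1 - s) * h2
  have hirr : ∀ s, Irreducible (φ s) → Irreducible (θ s) := by
    intro s hs
    refine ⟨fun hu => hs.not_isUnit ((hunit s).1 hu), fun {a b} hab => ?_⟩
    have key : ∀ a b, θ s = a * b → IsUnit (φ a) → IsUnit a := by
      intro a b hab ha
      obtain ⟨c, hc⟩ := ((hunit a).2 ha).exists_right_inv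
      rw [θ_def] at hab hc
      -- On the first component `c` inverts `a`; on the second `a * b = 1`, so `b` does.
      refine IsUnit.of_mul_eq_one (e * c + (1 - e) * b) ?_
      linear_combination e * hc - (1 - e) * hab + (1 - s + c - a * c) * he
    have : φ s = φ a * φ b := by rw [← map_mul, ← hab, hφθ]
    rcases hs.isUnit_or_isUnit this with ha | hb
    · exact .inl (key a b hab ha)
    · exact .inr (key b a (by rw [hab, mul_comm]) hb)
  have hirr' : ∀ (f : S) (s : S), f ∣ θ s → Irreducible f → Irreducible (φ f) := by
    rintro f s ⟨g, hg⟩ hf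
    -- `f` divides an element equal to `1` on the second component, so it is a unit there and
    -- differs from `θ f` only by a unit.
    have hu : IsUnit (e + (1 - e) * f) := by
      refine IsUnit.of_mul_eq_one (e + (1 - e) * g) ?_
      rw [θ_def] at hg
      linear_combination (e - 1) * hg + (2 + f * g - f - g - s) * he
    have hfac : f = θ f * (e + (1 - e) * f) := by
      rw [θ_def]; linear_combination (1 - f * 2 + f * f) * he
    have hθf : Irreducible (θ f) := by
      rw [hfac] at hf
      exact (irreducible_mul_isUnit hu).1 hf
    refine ⟨fun h' => hθf.not_isUnit ((hunit f).2 h'), fun {a b} hab => ?_⟩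
    obtain ⟨a, rfl⟩ := hφ a
    obtain ⟨b, rfl⟩ := hφ b
    rw [← hunit, ← hunit]
    refine hθf.isUnit_or_isUnit ?_
    rw [← map_mul]
    exact hθ (by simpa using hab)
  have hex : ∀ x : S', x ≠ 0 → ∃ f : Multiset S', (∀ b ∈ f, Irreducible b) ∧
      Associated f.prod x := by
    intro x hx
    by_cases hxu : IsUnit x
    · exact ⟨0, by simp, by simpa using (associated_one_iff_isUnit.2 hxu).symm⟩
    obtain ⟨s, rfl⟩ := hφ x
    obtain ⟨f, hf, hp⟩ := h.exists_factors (θ s) (hreg s hx) (mt (hunit s).1 hxu)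
    refine ⟨f.map φ, ?_, ?_⟩
    · intro y hy
      obtain ⟨z, hz, rfl⟩ := Multiset.mem_map.1 hy
      exact hirr' z s (hp ▸ Multiset.dvd_prod hz) (hf z hz)
    · rw [← map_multiset_prod, hp, hφθ]
  have hprime : ∀ p : S', Irreducible p → Prime p := by
    intro p hp
    refine ⟨hp.ne_zero, hp.not_isUnit, fun b c hbc => ?_⟩
    by_cases hb : b = 0
    · simp [hb]
    by_cases hc : c = 0
    · simp [hc]
    obtain ⟨f, hf, hfb⟩ := hex b hb
    obtain ⟨g, hg, hgc⟩ := hex c hc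
    -- `σ` is only a set-theoretic section, but `θ ∘ σ` is multiplicative because `θ` sees only the
    -- image under `φ`.
    let σ := Function.surjInv hφ
    have hσ : ∀ y, φ (σ y) = y := Function.surjInv_eq hφ
    have hdvd : p ∣ (f + g).prod := by
      rw [Multiset.prod_add]
      exact hbc.trans (hfb.mul_mul hgc).symm.dvd
    have hprod : ((f + g).map (fun y => θ (σ y))).prod = θ (σ (f + g).prod) := by
      rw [← Function.comp_def, ← Multiset.map_map, ← map_multiset_prod]
      exact hθ (by rw [map_multiset_prod, Multiset.map_map]; simp [hσ])
    obtain ⟨d, hd⟩ := hdvd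
    obtain ⟨y, hy, hpy⟩ := h.exists_dvd (θ (σ p)) ((f + g).map (fun y => θ (σ y)))
      (hirr _ (by rwa [hσ]))
      (by
        intro y hy
        obtain ⟨z, hz, rfl⟩ := Multiset.mem_map.1 hy
        refine hirr _ ?_
        rw [hσ]
        exact (Multiset.mem_add.1 hz).elim (hf z) (hg z))
      (by
        rw [hprod]
        refine hreg _ ?_
        rw [hσ, Multiset.prod_add, Ne, mul_eq_zero, hfb.eq_zero_iff, hgc.eq_zero_iff]
        tauto)
      (by
        rw [hprod]
        refine ⟨θ (σ d), ?_⟩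
        rw [← map_mul]
        exact hθ (by simp [hσ, hd]))
    obtain ⟨z, hz, rfl⟩ := Multiset.mem_map.1 hy
    have hpz : p ∣ z := by simpa [hφθ, hσ] using map_dvd φ hpy
    rcases Multiset.mem_add.1 hz with hz | hz
    · exact .inl (hpz.trans ((Multiset.dvd_prod hz).trans hfb.dvd))
    · exact .inr (hpz.trans ((Multiset.dvd_prod hz).trans hgc.dvd))
  refine UniqueFactorizationMonoid.of_exists_prime_factors fun x hx => ?_
  obtain ⟨f, hf, hfx⟩ := hex x hx
  exact ⟨f, fun b hb => hprime b (hf b hb), hfx⟩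

end Descent

/-! ### From a polynomial ring down to its coefficients -/

section Coefficients

variable {D : Type*} [CommRing D] [IsDomain D] {Λ : Type*}

theorem irreducible_C_mvPolynomial {p : D} (hp : Irreducible p) :
    Irreducible (MvPolynomial.C p : MvPolynomial Λ D) := by
  refine ⟨fun h => hp.not_isUnit ?_, fun {f g} h => ?_⟩
  · simpa using h.map (MvPolynomial.constantCoeff (σ := Λ) (R := D))
  · have hf0 : f ≠ 0 := by
      rintro rfl
      exact hp.ne_zero (by simpa using h)
    have hg0 : g ≠ 0 := by
      rintro rfl
      exact hp.ne_zero (by simpa using h)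
    have hdeg := congrArg MvPolynomial.totalDegree h
    rw [MvPolynomial.totalDegree_C, MvPolynomial.totalDegree_mul_of_isDomain hf0 hg0] at hdeg
    rw [MvPolynomial.totalDegree_eq_zero_iff_eq_C.1 (show f.totalDegree = 0 by omega),
      MvPolynomial.totalDegree_eq_zero_iff_eq_C.1 (show g.totalDegree = 0 by omega),
      ← map_mul, MvPolynomial.C_inj] at h
    rw [MvPolynomial.totalDegree_eq_zero_iff_eq_C.1 (show f.totalDegree = 0 by omega),
      MvPolynomial.totalDegree_eq_zero_iff_eq_C.1 (show g.totalDegree = 0 by omega)]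
    exact (hp.isUnit_or_isUnit h).imp (·.map _) (·.map _)

/-- `C` preserves strict divisibility and irreducibility, so well-foundedness pulls back; an
irreducible constant is prime among polynomials, hence prime in `D`. -/
theorem uniqueFactorizationMonoid_of_mvPolynomial
    [h : UniqueFactorizationMonoid (MvPolynomial Λ D)] : UniqueFactorizationMonoid D := by
  have hC : ∀ {a b : D}, DvdNotUnit a b →
      DvdNotUnit (MvPolynomial.C a : MvPolynomial Λ D) (MvPolynomial.C b) := by
    rintro a b ⟨ha, x, hx, rfl⟩
    refine ⟨by simpa using ha, MvPolynomial.C x, fun hu => hx ?_, by simp⟩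
    simpa using hu.map (MvPolynomial.constantCoeff (σ := Λ) (R := D))
  have wf : IsWellFounded D DvdNotUnit :=
    ⟨Subrelation.wf (fun hab => hC hab)
      (InvImage.wf (MvPolynomial.C : D → MvPolynomial Λ D) h.wf)⟩
  have : WfDvdMonoid D := wf
  exact { wf with
    irreducible_iff_prime := fun {a} =>
      ⟨fun ha => (MvPolynomial.prime_C_iff Λ).1 (Irreducible.prime (irreducible_C_mvPolynomial ha)),
        Prime.irreducible⟩ }

end Coefficients

/-! ### Each property restricts to regular elements -/

section ToRegular

variable {S : Type*} [CommRing S]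

/-- If `a = b * c` and `a ∣ b`, cancelling the regular element `a` makes `c` a unit. -/
theorem IsAtomElt.irreducible {a : S} (ha : IsAtomElt a) (hreg : a ∈ S⁰) : Irreducible a := by
  have key : ∀ b c : S, a = b * c → a ∣ b → IsUnit c := by
    rintro b c hbc ⟨d, hd⟩
    refine IsUnit.of_mul_eq_one d ?_
    have : (c * d - 1) * a = 0 := by
      linear_combination -(c * hd) - hbc
    exact sub_eq_zero.1 ((mem_nonZeroDivisors_iff_right.1 hreg) _ this)
  refine ⟨ha.1, fun {b c} hbc => ?_⟩
  rcases ha.2 b c hbc with h | h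
  · exact .inr (key b c hbc h.1)
  · exact .inl (key c b (by rw [hbc, mul_comm]) h.1)

theorem isAtomElt_of_irreducible {a : S} (ha : Irreducible a) : IsAtomElt a := by
  refine ⟨ha.not_isUnit, fun b c h => ?_⟩
  rcases ha.isUnit_or_isUnit h with hu | hu
  · exact .inr ⟨(by rw [h]; exact (hu.mul_left_dvd).2 dvd_rfl), ⟨b, by rw [h, mul_comm]⟩⟩
  · exact .inl ⟨(by rw [h]; exact (hu.mul_right_dvd).2 dvd_rfl), ⟨c, h⟩⟩

theorem VeryStrongAssoc.strongAssoc {a b : S} (h : VeryStrongAssoc a b) : StrongAssoc a b := by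
  obtain ⟨⟨_, r, hr⟩, h | ⟨_, h⟩⟩ := h
  · exact ⟨1, by simp [h.1, h.2]⟩
  · obtain ⟨w, hw⟩ := h r (by rw [hr, mul_comm])
    exact ⟨w, by rw [hw, mul_comm, hr]⟩

theorem StrongAssoc.assoc {a b : S} (h : StrongAssoc a b) : Assoc a b := by
  obtain ⟨w, rfl⟩ := h
  exact ⟨(w.isUnit.mul_left_dvd).2 dvd_rfl, Dvd.intro_left _ rfl⟩

theorem AtomType.IsIrred.isAtomElt {α : AtomType} {a : S} (h : α.IsIrred S a) : IsAtomElt a := by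
  cases α with
  | atomic => exact h
  | stronglyAtomic => exact ⟨h.1, fun b c hbc => (h.2 b c hbc).imp (·.assoc) (·.assoc)⟩
  | veryStronglyAtomic =>
    exact ⟨h.1, fun b c hbc => (h.2 b c hbc).imp (·.strongAssoc.assoc) (·.strongAssoc.assoc)⟩
  | mAtomic =>
    obtain ⟨⟨h1, _⟩, h2⟩ := h
    refine ⟨fun hu => h1 (Ideal.span_singleton_eq_top.2 hu), fun b c hbc => ?_⟩
    by_cases hb : IsUnit b
    · exact .inr ⟨by rw [hbc]; exact (hb.mul_left_dvd).2 dvd_rfl, ⟨b, by rw [hbc, mul_comm]⟩⟩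
    · refine .inl ⟨?_, ⟨c, hbc⟩⟩
      exact Ideal.span_singleton_le_span_singleton.1
        (h2 (y := Ideal.span {b}) ⟨mt Ideal.span_singleton_eq_top.1 hb, ⟨b, rfl⟩⟩
          (Ideal.span_singleton_le_span_singleton.2 ⟨c, hbc⟩))

theorem AtomType.isIrred_of_irreducible (α : AtomType) {a : S} (h : Irreducible a) :
    α.IsIrred S a := by
  have hs : ∀ b c : S, a = b * c → IsUnit b → VeryStrongAssoc a c := by
    intro b c hbc hb
    refine ⟨⟨by rw [hbc]; exact (hb.mul_left_dvd).2 dvd_rfl, ⟨b, by rw [hbc, mul_comm]⟩⟩,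
      .inr ⟨h.ne_zero, fun r hr => ?_⟩⟩
    exact (h.isUnit_or_isUnit hr).resolve_right
      fun hc => h.not_isUnit (by rw [hbc]; exact hb.mul hc)
  have hvs : IsVeryStrongAtomElt a := by
    refine ⟨h.not_isUnit, fun b c hbc => ?_⟩
    rcases h.isUnit_or_isUnit hbc with hb | hc
    · exact .inr (hs b c hbc hb)
    · exact .inl (hs c b (by rw [hbc, mul_comm]) hc)
  cases α with
  | atomic => exact isAtomElt_of_irreducible h
  | stronglyAtomic =>
    exact ⟨hvs.1, fun b c hbc => (hvs.2 b c hbc).imp (·.strongAssoc) (·.strongAssoc)⟩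
  | veryStronglyAtomic => exact hvs
  | mAtomic =>
    refine ⟨⟨mt Ideal.span_singleton_eq_top.1 h.not_isUnit, ⟨a, rfl⟩⟩, ?_⟩
    rintro J ⟨hJ, ⟨b, rfl⟩⟩ hle
    obtain ⟨c, hbc⟩ := Ideal.span_singleton_le_span_singleton.1 hle
    have hb : ¬ IsUnit b := mt Ideal.span_singleton_eq_top.2 hJ
    have hc := (h.isUnit_or_isUnit hbc).resolve_left hb
    refine Ideal.span_singleton_le_span_singleton.2 ?_
    rw [hbc]
    exact (hc.mul_right_dvd).2 dvd_rfl

theorem IsoType.AssocRel.assoc {β : IsoType} {a b : S} (h : β.AssocRel S a b) : Assoc a b := by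
  cases β with
  | isomorphic => exact h
  | stronglyIsomorphic => exact StrongAssoc.assoc h
  | veryStronglyIsomorphic => exact (VeryStrongAssoc.strongAssoc h).assoc

theorem IsFactorization.irreducible {P : S → Prop} (hP : ∀ x, P x → IsAtomElt x) {a : S}
    {s : Multiset S} (h : IsFactorization P a s) (ha : a ∈ S⁰) : ∀ x ∈ s, Irreducible x :=
  fun x hx => (hP x (h.1 x hx)).irreducible
    (mem_nonZeroDivisors_of_dvd ha (h.2 ▸ Multiset.dvd_prod hx))

theorem HasRegularFactorization.of_isAtomicFor [Nontrivial S] {P : S → Prop}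
    (hP : ∀ x, P x → IsAtomElt x)
    (h₁ : IsAtomicFor S P)
    (h₂ : ∀ s t : Multiset S, (∀ x ∈ s, Irreducible x) → (∀ x ∈ t, Irreducible x) →
      s.prod = t.prod → t.prod ∈ S⁰ → ¬ IsUnit t.prod → ∀ x ∈ s, ∃ y ∈ t, x ∣ y) :
    HasRegularFactorization S :=
  .of_exists_dvd (fun a ha hu => by
    obtain ⟨s, hs⟩ := h₁ a (nonZeroDivisors.ne_zero ha) hu
    exact ⟨s, hs.irreducible hP ha, hs.2.symm⟩) h₂

theorem IsUFROfType.hasRegularFactorization [Nontrivial S] {α : AtomType} {β : IsoType}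
    (h : IsUFROfType S α β) : HasRegularFactorization S := by
  refine .of_isAtomicFor (fun x => AtomType.IsIrred.isAtomElt) h.1 ?_
  intro s t hs ht hst hreg hu x hx
  obtain ⟨y, hy, hxy⟩ := Multiset.exists_mem_of_rel_of_mem
    (h.2 t.prod (nonZeroDivisors.ne_zero hreg) hu s t
      ⟨fun x hx => α.isIrred_of_irreducible (hs x hx), hst.symm⟩
      ⟨fun x hx => α.isIrred_of_irreducible (ht x hx), rfl⟩) hx
  exact ⟨y, hy, (IsoType.AssocRel.assoc hxy).1⟩

theorem IsWeakUFR.hasRegularFactorization [Nontrivial S] (h : IsWeakUFR S) :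
    HasRegularFactorization S := by
  refine .of_isAtomicFor (fun _ => id) h.1 ?_
  intro s t hs ht hst hreg hu
  exact (h.2 t.prod (nonZeroDivisors.ne_zero hreg) hu s t
    ⟨fun x hx => isAtomElt_of_irreducible (hs x hx), hst.symm⟩
    ⟨fun x hx => isAtomElt_of_irreducible (ht x hx), rfl⟩).1

theorem IsHomomorphicAtomic.isWeakUFR (h : IsHomomorphicAtomic S) : IsWeakUFR S := by
  refine ⟨h.1, fun a ha hu s t hs ht => ?_⟩
  obtain ⟨h1, h2⟩ := h.2 a ha hu s t hs ht
  exact ⟨fun x hx => (h1 x hx).imp fun _ h => ⟨h.1, h.2.1⟩,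
    fun x hx => (h2 x hx).imp fun _ h => ⟨h.1, h.2.1⟩⟩

theorem IsFactorialRing.hasRegularFactorization (h : IsFactorialRing S) :
    HasRegularFactorization S := by
  refine .of_exists_dvd (fun a ha hu => ?_) ?_
  · obtain ⟨s, hs⟩ := h.1 a ha hu
    exact ⟨s, hs.irreducible (fun _ => id) ha, hs.2.symm⟩
  intro s t hs ht hst hreg hu x hx
  obtain ⟨y, hy, hxy⟩ := Multiset.exists_mem_of_rel_of_mem
    (h.2 t.prod hreg hu s t
      ⟨fun x hx => isAtomElt_of_irreducible (hs x hx), hst.symm⟩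
      ⟨fun x hx => isAtomElt_of_irreducible (ht x hx), rfl⟩) hx
  exact ⟨y, hy, hxy.1⟩

/-- This cancellation is why no nonunit factor of a regular product is superfluous. -/
theorem isUnit_of_mul_dvd_of_mem_nonZeroDivisors {a b : S} (hb : b ∈ S⁰) (h : a * b ∣ b) :
    IsUnit a := by
  obtain ⟨c, hc⟩ := h
  refine IsUnit.of_mul_eq_one c ?_
  refine sub_eq_zero.1 ((mem_nonZeroDivisors_iff_right.1 hb) _ ?_)
  linear_combination -hc

theorem isUDecomposition_zero_of_irreducible {t : Multiset S} (ht : ∀ x ∈ t, Irreducible x)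
    (hreg : t.prod ∈ S⁰) : IsUDecomposition t.prod 0 t := by
  refine ⟨by simp, fun x hx => isAtomElt_of_irreducible (ht x hx), by simp, by simp, ?_⟩
  rintro y q' rfl hy
  rw [Multiset.prod_cons] at hreg
  refine (ht y (by simp)).not_isUnit (isUnit_of_mul_dvd_of_mem_nonZeroDivisors
    (mul_mem_nonZeroDivisors.1 hreg).2 (b := q'.prod) ?_)
  exact Ideal.span_singleton_le_span_singleton.1 (le_of_eq (Eq.symm hy))

theorem IsFletcherUFR.hasRegularFactorization (h : IsFletcherUFR S) :
    HasRegularFactorization S := by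
  refine .of_exists_dvd (fun a ha hu => ?_) ?_
  · obtain ⟨p, q, hp, hq, hpq, -⟩ := h.1 a hu
    have : IsFactorization IsAtomElt a (p + q) :=
      ⟨fun x hx => (Multiset.mem_add.1 hx).elim (hp x) (hq x), by rw [hpq, Multiset.prod_add]⟩
    exact ⟨p + q, this.irreducible (fun _ => id) ha, this.2.symm⟩
  intro s t hs ht hst hreg hu x hx
  have hs' := isUDecomposition_zero_of_irreducible hs (hst ▸ hreg)
  rw [hst] at hs'
  obtain ⟨y, hy, hxy⟩ := Multiset.exists_mem_of_rel_of_mem (h.2 t.prod hu _ _ _ _ hs'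
    (isUDecomposition_zero_of_irreducible ht hreg)) hx
  exact ⟨y, hy, hxy.1⟩

theorem isStronglyMuReducedFact_of_irreducible {s : Multiset S} (hs : ∀ x ∈ s, Irreducible x)
    (hreg : s.prod ∈ S⁰) (l : Sˣ) : IsStronglyMuReducedFact l s := by
  intro t hts l' heq
  obtain ⟨x, hx⟩ := Multiset.lt_iff_cons_le.1 hts
  obtain ⟨r, rfl⟩ := Multiset.le_iff_exists_add.1 hx
  refine (hs x (by simp)).not_isUnit (isUnit_of_mul_dvd_of_mem_nonZeroDivisors (b := t.prod) ?_ ?_)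
  · exact mem_nonZeroDivisors_of_dvd hreg (Multiset.prod_dvd_prod_of_le hts.le)
  · have h1 : x * t.prod ∣ ((x ::ₘ t) + r).prod := by simp [← mul_assoc]
    have h2 : ((x ::ₘ t) + r).prod ∣ (l' : S) * t.prod := ⟨l, by rw [← heq, mul_comm]⟩
    exact h1.trans (h2.trans ((l'.isUnit.mul_left_dvd).2 dvd_rfl))

/-- This is the weakest of the four `μ`-reduced conditions: it compares the fewest factorizations
and ignores `0`. The other three reduce to it. -/
theorem IsWeakStronglyMuReducedUFR.hasRegularFactorization [Nontrivial S]
    (h : IsWeakStronglyMuReducedUFR S) :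
    HasRegularFactorization S := by
  refine .of_isAtomicFor (fun _ => id) h.1 ?_
  intro s t hs ht hst hreg hu x hx
  obtain ⟨y, hy, hxy⟩ := Multiset.exists_mem_of_rel_of_mem
    (h.2 t.prod (nonZeroDivisors.ne_zero hreg) hu 1 1 s t
      (fun x hx => isAtomElt_of_irreducible (hs x hx)) (by simp [hst])
      (isStronglyMuReducedFact_of_irreducible hs (hst ▸ hreg) 1)
      (fun x hx => isAtomElt_of_irreducible (ht x hx)) (by simp)
      (isStronglyMuReducedFact_of_irreducible ht hreg 1)) hx
  exact ⟨y, hy, hxy.1⟩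

end ToRegular

/-! ### Implications between the reduced variants -/

section Weakening

variable {S : Type*} [CommRing S] {Q Q' : Sˣ → Multiset S → Prop}

theorem HasUniqueQFactorization.mono (hQ : ∀ l s, Q' l s → Q l s)
    (h : HasUniqueQFactorization S Q) : HasUniqueQFactorization S Q' :=
  ⟨h.1, fun a hu l₁ l₂ s t hs hsa hQs ht hta hQt =>
    h.2 a hu l₁ l₂ s t hs hsa (hQ _ _ hQs) ht hta (hQ _ _ hQt)⟩

theorem HasWeakUniqueQFactorization.mono (hQ : ∀ l s, Q' l s → Q l s)
    (h : HasWeakUniqueQFactorization S Q) : HasWeakUniqueQFactorization S Q' :=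
  ⟨h.1, fun a ha hu l₁ l₂ s t hs hsa hQs ht hta hQt =>
    h.2 a ha hu l₁ l₂ s t hs hsa (hQ _ _ hQs) ht hta (hQ _ _ hQt)⟩

theorem HasUniqueQFactorization.weak (h : HasUniqueQFactorization S Q) :
    HasWeakUniqueQFactorization S Q :=
  ⟨h.1, fun a _ hu => h.2 a hu⟩

theorem IsStronglyMuReducedFact.isMuReducedFact {l : Sˣ} {s : Multiset S}
    (h : IsStronglyMuReducedFact l s) : IsMuReducedFact l s := by
  rintro x t rfl l'
  exact h t (Multiset.lt_cons_self t x) l'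

theorem IsStronglyReducedFact.isReducedFact {l : Sˣ} {s : Multiset S}
    (h : IsStronglyReducedFact l s) : IsReducedFact l s := by
  rintro x t rfl
  exact h t (Multiset.lt_cons_self t x)

theorem IsStronglyMuReducedFact.isStronglyReducedFact {l : Sˣ} {s : Multiset S}
    (h : IsStronglyMuReducedFact l s) : IsStronglyReducedFact l s :=
  fun t ht => h t ht l

end Weakening

/-! ### Decomposing the coefficient ring by factoring an indeterminate -/

section PolynomialRing

variable {R : Type*} [CommRing R] {Λ : Type*}

/-- The constant term of the derivative of `f * g = X i` gives a Bézout relation. -/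
theorem isCoprime_constantCoeff_of_mul_eq_X {f g : MvPolynomial Λ R} {i : Λ}
    (h : f * g = MvPolynomial.X i) :
    IsCoprime (MvPolynomial.constantCoeff f) (MvPolynomial.constantCoeff g) := by
  have := congrArg (fun p => MvPolynomial.constantCoeff (MvPolynomial.pderiv i p)) h
  simp only [MvPolynomial.pderiv_mul, MvPolynomial.pderiv_X_self, map_add, map_mul, map_one] at this
  exact ⟨MvPolynomial.constantCoeff (MvPolynomial.pderiv i g),
    MvPolynomial.constantCoeff (MvPolynomial.pderiv i f), by linear_combination this⟩

/-- The substitution `MvPolynomial.X i ↦ MvPolynomial.X i + MvPolynomial.C c`. -/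
noncomputable def shift (i : Λ) (c : R) : MvPolynomial Λ R →ₐ[R] MvPolynomial Λ R := by
  classical
  exact MvPolynomial.aeval fun j => MvPolynomial.X j + if j = i then MvPolynomial.C c else 0

theorem shift_X (i : Λ) (c : R) :
    shift i c (MvPolynomial.X i) = MvPolynomial.X i + MvPolynomial.C c := by
  simp [shift]

theorem shift_shift_neg (i : Λ) (c : R) (p : MvPolynomial Λ R) :
    shift i c (shift i (-c) p) = p := by
  have : (shift i c).comp (shift i (-c)) = AlgHom.id R (MvPolynomial Λ R) := by
    ext j : 1
    by_cases hj : j = i <;> simp [shift, hj]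
  exact DFunLike.congr_fun this p

/-- The substitution `X i ↦ X i + C c` as an automorphism. -/
noncomputable def shiftEquiv (i : Λ) (c : R) : MvPolynomial Λ R ≃ₐ[R] MvPolynomial Λ R :=
  AlgEquiv.ofAlgHom (shift i c) (shift i (-c))
    (by ext1 j; exact shift_shift_neg i c _)
    (by ext1 j; simpa using shift_shift_neg i (-c) (MvPolynomial.X j))

/-- Since `ab = 0`, `X i` divides `(X i + a)(X i + b)`. Translating `s` by `a` and by `b` factors
this regular product into irreducibles, and a factor of `X i + a` has constant term dividing `a`. -/
theorem HasRegularFactorization.constantCoeff_dvd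
    (h : HasRegularFactorization (MvPolynomial Λ R)) {i : Λ} {s : Multiset (MvPolynomial Λ R)}
    (hs : ∀ f ∈ s, Irreducible f) (hprod : s.prod = MvPolynomial.X i)
    {f : MvPolynomial Λ R} (hf : f ∈ s) {a b : R} (hab : a * b = 0) :
    MvPolynomial.constantCoeff f ∣ a ∨ MvPolynomial.constantCoeff f ∣ b := by
  have hX : ∀ c : R, (s.map (shiftEquiv i c)).prod = MvPolynomial.X i + MvPolynomial.C c := by
    intro c
    rw [← map_multiset_prod, hprod]
    exact shift_X i c
  have hreg : ∀ c : R, (MvPolynomial.X i + MvPolynomial.C c : MvPolynomial Λ R) ∈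
      (MvPolynomial Λ R)⁰ := by
    intro c
    rw [mem_nonZeroDivisors_iff_right]
    intro x hx
    have := (MvPolynomial.isRegular_X (R := R) (n := i)).mem_nonZeroDivisors
    rw [mem_nonZeroDivisors_iff_right] at this
    refine (map_eq_zero_iff (shiftEquiv i (-c)) (shiftEquiv i (-c)).injective).1 (this _ ?_)
    have h2 := congrArg (shiftEquiv i (-c)) hx
    have h3 : shiftEquiv i (-c) (MvPolynomial.X i + MvPolynomial.C c) = MvPolynomial.X i := by
      have : shiftEquiv i (-c) (MvPolynomial.C c) = MvPolynomial.C c := (shiftEquiv i (-c)).commutes c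
      rw [map_add, this]
      erw [shift_X]
      simp
    rw [map_mul, h3, map_zero] at h2
    exact h2
  have hdvd : ∀ c : R, ∀ g ∈ s.map (shiftEquiv i c), MvPolynomial.constantCoeff g ∣ c := by
    intro c g hg
    have := map_dvd MvPolynomial.constantCoeff (Multiset.dvd_prod hg)
    rwa [hX, map_add, MvPolynomial.constantCoeff_X, MvPolynomial.constantCoeff_C, zero_add] at this
  have hirr : ∀ c : R, ∀ g ∈ s.map (shiftEquiv i c), Irreducible g := by
    intro c g hg
    obtain ⟨g', hg', rfl⟩ := Multiset.mem_map.1 hg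
    exact (MulEquiv.irreducible_iff (shiftEquiv i c)).2 (hs g' hg')
  obtain ⟨g, hg, hfg⟩ := h.exists_dvd f (s.map (shiftEquiv i a) + s.map (shiftEquiv i b))
    (hs f hf)
    (fun g hg => (Multiset.mem_add.1 hg).elim (hirr a g) (hirr b g))
    (by
      rw [Multiset.prod_add, hX, hX]
      exact mul_mem_nonZeroDivisors.2 ⟨hreg a, hreg b⟩)
    (by
      rw [Multiset.prod_add, hX, hX]
      refine (Multiset.dvd_prod hf).trans ?_
      rw [hprod]
      refine ⟨MvPolynomial.X i + MvPolynomial.C a + MvPolynomial.C b, ?_⟩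
      have : (MvPolynomial.C a : MvPolynomial Λ R) * MvPolynomial.C b = 0 := by
        rw [← MvPolynomial.C_mul, hab, MvPolynomial.C_0]
      linear_combination this)
  have hc := map_dvd MvPolynomial.constantCoeff hfg
  exact (Multiset.mem_add.1 hg).imp (fun hg => hc.trans (hdvd a g hg))
    (fun hg => hc.trans (hdvd b g hg))

theorem HasRegularFactorization.isFiniteProductOfUFDs {R : Type u} [CommRing R] {Λ : Type v}
    [Nontrivial R] [Nonempty Λ] (h : HasRegularFactorization (MvPolynomial Λ R)) :
    IsFiniteProductOfUFDs R := by
  classical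
  let i : Λ := Classical.arbitrary Λ
  obtain ⟨s, hs, hprod⟩ := h.exists_factors (MvPolynomial.X i)
      MvPolynomial.isRegular_X.mem_nonZeroDivisors (by
    intro hu
    simpa using hu.map (MvPolynomial.constantCoeff (σ := Λ) (R := R)))
  obtain ⟨l, rfl⟩ : ∃ l : List (MvPolynomial Λ R), s = l := ⟨s.toList, by simp⟩
  let c : Fin l.length → R := fun k => MvPolynomial.constantCoeff l[k]
  have hpl : ∏ k : Fin l.length, l[k] = MvPolynomial.X i := by
    rw [← hprod, Multiset.prod_coe]; exact Fin.prod_univ_getElem l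
  have hc0 : ∏ k, c k = 0 := by
    rw [← map_prod, hpl, MvPolynomial.constantCoeff_X]
  have hcop : ∀ k, IsCoprime (c k) (∏ j ∈ Finset.univ.erase k, c j) := by
    intro k
    rw [← map_prod]
    apply isCoprime_constantCoeff_of_mul_eq_X (i := i)
    rw [Finset.mul_prod_erase _ (fun k : Fin l.length => l[k]) (Finset.mem_univ k), hpl]
  have hcop' : ∀ k j, k ≠ j → IsCoprime (c k) (c j) := fun k j hkj =>
    (hcop k).of_isCoprime_of_dvd_right (Finset.dvd_prod_of_mem _ (by simp [hkj.symm]))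
  have hker : ∀ k, ∃ e : R, e * e = e ∧ ∀ x, c k ∣ x ↔ e * x = 0 := by
    intro k
    obtain ⟨a, b, hab⟩ := hcop k
    have h0 : c k * ∏ j ∈ Finset.univ.erase k, c j = 0 := by
      rw [Finset.mul_prod_erase _ c (Finset.mem_univ k), hc0]
    set r := ∏ j ∈ Finset.univ.erase k, c j
    -- From `a * c k + b * r = 1` and `c k * r = 0`, the element `b * r` is idempotent with
    -- annihilator generated by `c k`.
    refine ⟨b * r, by linear_combination (b * r) * hab - (a * b) * h0, fun x => ⟨?_, ?_⟩⟩
    · rintro ⟨y, rfl⟩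
      linear_combination (b * y) * h0
    · intro hx
      exact ⟨a * x, by linear_combination -x * hab + hx⟩
  have hprime : ∀ k, ¬ IsUnit (c k) → (Ideal.span {c k}).IsPrime := by
    intro k hk
    refine ⟨mt Ideal.span_singleton_eq_top.1 hk, fun {x y} hxy => ?_⟩
    simp only [Ideal.mem_span_singleton] at hxy ⊢
    obtain ⟨e, he, hex⟩ := hker k
    have h1 : (e * x) * (e * y) = 0 := by
      linear_combination (x * y) * he + (hex _).1 hxy
    have h2 := h.constantCoeff_dvd hs hprod (f := l[k]) (by simp) h1
    simp only [hex]
    refine h2.imp (fun h => ?_) (fun h => ?_)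
    · linear_combination (hex _).1 h - x * he
    · linear_combination (hex _).1 h - y * he
  -- A unit constant term would give a zero quotient ring, which is not a domain; those indices are
  -- dropped without changing the intersection.
  let J := {k // ¬ IsUnit (c k)}
  let I : J → Ideal R := fun k => Ideal.span {c k}
  have hinf : ⨅ k, I k = ⊥ := by
    rw [eq_bot_iff]
    have : ⨅ k, Ideal.span {c k} = (⊥ : Ideal R) := by
      rw [Ideal.iInf_span_singleton hcop', hc0]; simp
    rw [← this]
    refine le_iInf fun k => ?_
    by_cases hk : IsUnit (c k)
    · rw [Ideal.span_singleton_eq_top.2 hk]; exact le_top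
    · exact iInf_le I ⟨k, hk⟩
  have hI : Pairwise (Function.onFun IsCoprime I) := by
    intro k j hkj
    exact Ideal.isCoprime_span_singleton_iff _ _ |>.2
      (hcop' k j fun h => hkj (Subtype.ext h))
  let E : R ≃+* ∀ k, R ⧸ I k := (RingEquiv.quotientBot R).symm.trans
    ((Ideal.quotEquivOfEq hinf.symm).trans (Ideal.quotientInfRingEquivPiQuotient I hI))
  let σ : Fin (Fintype.card J) ≃ J := (Fintype.equivFin J).symm
  refine ⟨Fintype.card J, fun k => R ⧸ I (σ k), fun _ => inferInstance, fun k => ?_,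
    ⟨E.trans (RingEquiv.piCongrLeft (fun k => R ⧸ I k) σ).symm⟩⟩
  have hp := hprime (σ k).1 (σ k).2
  have hd : IsDomain (R ⧸ I (σ k)) := (Ideal.Quotient.isDomain_iff_prime _).2 hp
  obtain ⟨e, he, hex⟩ := hker (σ k).1
  refine ⟨hd, ?_⟩
  have : UniqueFactorizationMonoid (MvPolynomial Λ (R ⧸ I (σ k))) := by
    refine h.uniqueFactorizationMonoid (MvPolynomial.map (Ideal.Quotient.mk (I (σ k))))
      (MvPolynomial.map_surjective _ Ideal.Quotient.mk_surjective) (MvPolynomial.C e)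
      (by rw [← MvPolynomial.C_mul, he]) fun f => ?_
    simp only [MvPolynomial.ext_iff, MvPolynomial.coeff_map, MvPolynomial.coeff_C_mul,
      MvPolynomial.coeff_zero, Ideal.Quotient.eq_zero_iff_mem]
    refine forall_congr' fun m => ?_
    rw [← hex, Ideal.mem_span_singleton]
  exact uniqueFactorizationMonoid_of_mvPolynomial (Λ := Λ)

end PolynomialRing

/-! ### Products without superfluous factors -/

section Redundancy

variable {S : Type*} [CommRing S]

theorem Assoc.refl (a : S) : Assoc a a := ⟨dvd_rfl, dvd_rfl⟩

theorem Assoc.symm {a b : S} (h : Assoc a b) : Assoc b a := ⟨h.2, h.1⟩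

theorem Assoc.trans {a b c : S} (h : Assoc a b) (h' : Assoc b c) : Assoc a c :=
  ⟨h.1.trans h'.1, h'.2.trans h.2⟩

theorem Assoc.mul_left {a b : S} (c : S) (h : Assoc a b) : Assoc (c * a) (c * b) :=
  ⟨mul_dvd_mul_left c h.1, mul_dvd_mul_left c h.2⟩

theorem assoc_unit_mul (l : Sˣ) (a : S) : Assoc (l * a) a :=
  ⟨(l.isUnit.mul_left_dvd).2 dvd_rfl, Dvd.intro_left _ rfl⟩

/-- No factor of `s` can be omitted without changing the principal ideal of the product. -/
def Irredundant (s : Multiset S) : Prop :=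
  ∀ (x : S) (t : Multiset S), s = x ::ₘ t → ¬ Assoc s.prod t.prod

theorem Irredundant.of_cons {x : S} {s : Multiset S} (h : Irredundant (x ::ₘ s)) :
    Irredundant s := by
  rintro y t rfl hy
  refine h y (x ::ₘ t) (Multiset.cons_swap x y t) ?_
  simpa only [Multiset.prod_cons] using Assoc.mul_left x hy

theorem irredundant_of_mem_nonZeroDivisors {s : Multiset S} (hs : ∀ x ∈ s, IsAtomElt x)
    (hreg : s.prod ∈ S⁰) : Irredundant s := by
  rintro x t rfl h
  rw [Multiset.prod_cons] at h hreg
  exact (hs x (by simp)).1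
    (isUnit_of_mul_dvd_of_mem_nonZeroDivisors (mul_mem_nonZeroDivisors.1 hreg).2 h.1)

/-- Superfluous factors are deleted one at a time; the multiset is finite. -/
theorem exists_irredundant_le (s : Multiset S) :
    ∃ q ≤ s, Assoc s.prod q.prod ∧ Irredundant q := by
  induction s using Multiset.strongInductionOn with
  | ih s ih =>
    by_cases h : Irredundant s
    · exact ⟨s, le_rfl, .refl _, h⟩
    · simp only [Irredundant, not_forall, not_not] at h
      obtain ⟨x, t, rfl, h⟩ := h
      obtain ⟨q, hq, hqa, hqi⟩ := ih t (Multiset.lt_cons_self t x)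
      exact ⟨q, hq.trans (Multiset.le_cons_self t x), h.trans hqa, hqi⟩

theorem mem_fletcherU_iff {x r : S} : x ∈ fletcherU r ↔ Assoc (x * r) r := by
  simp only [fletcherU, Set.mem_ofPred_eq, le_antisymm_iff, Ideal.span_singleton_le_span_singleton]
  exact and_comm

theorem IsUDecomposition.irredundant {a : S} {p q : Multiset S} (h : IsUDecomposition a p q) :
    Irredundant q := by
  rintro x t rfl hx
  refine h.2.2.2.2 x t rfl (mem_fletcherU_iff.2 ?_)
  simpa using hx

theorem IsUDecomposition.assoc {a : S} {p q : Multiset S} (h : IsUDecomposition a p q) :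
    Assoc a q.prod := by
  obtain ⟨-, -, rfl, h, -⟩ := h
  induction p using Multiset.induction_on with
  | empty => simpa using Assoc.refl _
  | cons x p ih =>
    have h1 := ih fun y hy => h y (Multiset.mem_cons_of_mem hy)
    have h2 := mem_fletcherU_iff.1 (h x (by simp))
    rw [Multiset.prod_cons, mul_assoc]
    exact (h1.mul_left x).trans h2

/-- An irredundant part generating the same ideal supplies the `b_j`; any remaining factor fixes
that ideal, since its product with the `b_j` divides the whole product. -/
theorem exists_isUDecomposition {a : S} {s : Multiset S} (h : IsFactorization IsAtomElt a s) :
    ∃ p q : Multiset S, IsUDecomposition a p q := by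
  obtain ⟨hs, rfl⟩ := h
  obtain ⟨q, hq, hqa, hqi⟩ := exists_irredundant_le s
  obtain ⟨p, rfl⟩ := Multiset.le_iff_exists_add.1 hq
  refine ⟨p, q, fun x hx => hs x (by simp [hx]), fun x hx => hs x (by simp [hx]),
    by rw [Multiset.prod_add, mul_comm], fun x hx => ?_, ?_⟩
  · rw [mem_fletcherU_iff]
    refine ⟨?_, Dvd.intro_left _ rfl⟩
    refine dvd_trans ?_ hqa.1
    rw [Multiset.prod_add, mul_comm x]
    exact mul_dvd_mul_left _ (Multiset.dvd_prod hx)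
  · rintro y q' rfl hy
    refine hqi y q' rfl ?_
    simpa using mem_fletcherU_iff.1 hy

end Redundancy

/-! ### Factorization in products of domains and of UFDs -/

section Product

variable {ι : Type*} {E : ι → Type*} [∀ i, CommRing (E i)] {S : Type*} [CommRing S]

theorem isUnit_iff_forall (e : S ≃+* ∀ i, E i) {a : S} : IsUnit a ↔ ∀ i, IsUnit (e a i) := by
  rw [← Pi.isUnit_iff, MulEquiv.isUnit_map]

theorem apply_prod_eq_zero (e : S ≃+* ∀ i, E i) {i : ι} {s : Multiset S} {z : S} (hz : z ∈ s)
    (h : e z i = 0) :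
    e s.prod i = 0 := by
  obtain ⟨r, hr⟩ := Multiset.dvd_prod hz
  rw [hr, map_mul, Pi.mul_apply, h, zero_mul]

theorem isUnit_apply_prod (e : S ≃+* ∀ i, E i) {i : ι} {s : Multiset S}
    (h : ∀ z ∈ s, IsUnit (e z i)) :
    IsUnit (e s.prod i) := by
  induction s using Multiset.induction_on with
  | empty => simp
  | cons x s ih =>
    rw [Multiset.prod_cons, map_mul, Pi.mul_apply]
    exact (h x (by simp)).mul (ih fun z hz => h z (Multiset.mem_cons_of_mem hz))

theorem apply_dvd (e : S ≃+* ∀ i, E i) {a b : S} (h : a ∣ b) (i : ι) : e a i ∣ e b i :=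
  map_dvd ((Pi.evalRingHom E i).comp (e : S →+* ∀ i, E i)) h

theorem dvd_of_forall (e : S ≃+* ∀ i, E i) {a b : S} (h : ∀ i, e a i ∣ e b i) : a ∣ b := by
  choose c hc using h
  refine ⟨e.symm c, e.injective ?_⟩
  rw [map_mul, e.apply_symm_apply]
  exact funext hc

theorem assoc_of_forall (e : S ≃+* ∀ i, E i) {a b : S}
    (h : ∀ i, Associated (e a i) (e b i)) : Assoc a b :=
  ⟨dvd_of_forall e fun i => (h i).dvd, dvd_of_forall e fun i => (h i).symm.dvd⟩

/-- `a` is a unit in every coordinate except the `i`-th, where it is zero or prime. -/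
def IsPrimeAt (e : S ≃+* ∀ i, E i) (i : ι) (a : S) : Prop :=
  (e a i = 0 ∨ Prime (e a i)) ∧ ∀ j ≠ i, IsUnit (e a j)

theorem IsPrimeAt.eq_of_not_isUnit {e : S ≃+* ∀ i, E i} {i j : ι} {a : S} (h : IsPrimeAt e i a)
    (hj : ¬ IsUnit (e a j)) : j = i :=
  not_not.1 fun hji => hj (h.2 j hji)

/-- A second factor that is a nonunit at `i` would be a unit elsewhere and be absorbed by the zero
of `x` at `i`, hence superfluous. -/
theorem isUnit_apply_of_irredundant {e : S ≃+* ∀ i, E i} {i : ι} {x : S} {s : Multiset S}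
    (hs : ∀ y ∈ x ::ₘ s, ∃ j, IsPrimeAt e j y) (h : Irredundant (x ::ₘ s)) (hx : e x i = 0) :
    IsUnit (e s.prod i) := by
  refine isUnit_apply_prod e fun z hz => ?_
  by_contra hzu
  obtain ⟨r, rfl⟩ := Multiset.exists_cons_of_mem hz
  obtain ⟨j, hj⟩ := hs z (by simp)
  obtain rfl := hj.eq_of_not_isUnit hzu
  refine h z (x ::ₘ r) (Multiset.cons_swap x z r) (assoc_of_forall e fun k => ?_)
  rw [Multiset.cons_swap, Multiset.prod_cons, map_mul, Pi.mul_apply]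
  by_cases hk : k = i
  · subst hk
    simp [hx]
  · exact associated_unit_mul_left _ _ (hj.2 k hk)

variable [∀ i, IsDomain (E i)]

theorem Assoc.apply {e : S ≃+* ∀ i, E i} {a b : S} (h : Assoc a b)
    (i : ι) : Associated (e a i) (e b i) :=
  associated_of_dvd_dvd (apply_dvd e h.1 i) (apply_dvd e h.2 i)

/-- In each coordinate, a domain, mutual divisibility is equality up to a unit, and these units
assemble. Hence being `μ`-reduced amounts to a condition on principal ideals. -/
theorem Assoc.strongAssoc_of_pi (e : S ≃+* ∀ i, E i) {a b : S}
    (h : Assoc a b) : StrongAssoc a b := by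
  choose w hw using fun i => (h.symm.apply (e := e) i)
  refine ⟨Units.map e.symm.toMonoidHom (MulEquiv.piUnits.symm w), e.injective ?_⟩
  funext i
  rw [map_mul, Pi.mul_apply, ← hw i, mul_comm]
  simp

theorem IsMuReducedFact.irredundant (e : S ≃+* ∀ i, E i) {l : Sˣ} {s : Multiset S}
    (h : IsMuReducedFact l s) :
    Irredundant s := by
  rintro x t rfl hx
  obtain ⟨w, hw⟩ := hx.strongAssoc_of_pi e
  exact h x t rfl (l * w) (by rw [hw, Units.val_mul, mul_assoc])

theorem IsPrimeAt.not_isUnit {e : S ≃+* ∀ i, E i} {i : ι} {a : S}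
    (h : IsPrimeAt e i a) : ¬ IsUnit (e a i) := by
  rcases h.1 with h | h
  · simp [h]
  · exact h.not_isUnit

theorem IsPrimeAt.isAtomElt {e : S ≃+* ∀ i, E i} {i : ι} {a : S} (h : IsPrimeAt e i a) :
    IsAtomElt a := by
  refine ⟨fun hu => h.not_isUnit ((isUnit_iff_forall e).1 hu i), ?_⟩
  have key : ∀ b c : S, a = b * c → Associated (e a i) (e b i) → Assoc a b := by
    rintro b c hbc hb
    refine assoc_of_forall e fun j => ?_
    by_cases hj : j = i
    · exact hj ▸ hb
    · have hu := h.2 j hj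
      refine (associated_one_iff_isUnit.2 hu).trans (associated_one_iff_isUnit.2 ?_).symm
      exact isUnit_of_dvd_unit (apply_dvd e ⟨c, hbc⟩ j) hu
  intro b c hbc
  have hi : e a i = e b i * e c i := by rw [hbc, map_mul, Pi.mul_apply]
  have : Associated (e a i) (e b i) ∨ Associated (e a i) (e c i) := by
    rcases h.1 with h0 | hp
    · rw [h0] at hi ⊢
      rcases mul_eq_zero.1 hi.symm with h | h <;> simp [h]
    · rcases hp.irreducible.isUnit_or_isUnit hi with hu | hu
      · rw [hi]; exact .inr (associated_unit_mul_left _ _ hu)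
      · rw [hi]; exact .inl (associated_mul_unit_left _ _ hu)
  exact this.imp (key b c hbc) (key c b (by rw [hbc, mul_comm]))

theorem IsPrimeAt.dvd_or_dvd {e : S ≃+* ∀ i, E i} {i : ι} {p a b : S} (h : IsPrimeAt e i p)
    (hab : p ∣ a * b) :
    p ∣ a ∨ p ∣ b := by
  have key : ∀ c, e p i ∣ e c i → p ∣ c := by
    intro c hc
    refine dvd_of_forall e fun j => ?_
    by_cases hj : j = i
    · exact hj ▸ hc
    · exact (h.2 j hj).dvd
  have hi := apply_dvd e hab i
  rw [map_mul, Pi.mul_apply] at hi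
  have : e p i ∣ e a i ∨ e p i ∣ e b i := by
    rcases h.1 with h0 | hp
    · rw [h0] at hi ⊢
      simpa only [zero_dvd_iff, mul_eq_zero] using hi
    · exact hp.dvd_or_dvd hi
  exact this.imp (key a) (key b)

theorem IsPrimeAt.exists_mem_dvd {e : S ≃+* ∀ i, E i} {i : ι} {p : S}
    (h : IsPrimeAt e i p) {s : Multiset S}
    (hs : p ∣ s.prod) : ∃ y ∈ s, p ∣ y := by
  induction s using Multiset.induction_on with
  | empty =>
    rw [Multiset.prod_zero] at hs
    exact absurd (isUnit_of_dvd_one hs) h.isAtomElt.1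
  | cons x s ih =>
    rw [Multiset.prod_cons] at hs
    rcases h.dvd_or_dvd hs with h1 | h1
    · exact ⟨x, by simp, h1⟩
    · obtain ⟨y, hy, hpy⟩ := ih h1
      exact ⟨y, by simp [hy], hpy⟩

/-- In a finite product of domains, irredundant products of elements that are zero or prime in
one coordinate and units elsewhere are unique. -/
theorem rel_assoc_of_irredundant {e : S ≃+* ∀ i, E i} {s t : Multiset S}
    (hs : ∀ x ∈ s, ∃ i, IsPrimeAt e i x)
    (ht : ∀ x ∈ t, ∃ i, IsPrimeAt e i x) (hst : Assoc s.prod t.prod)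
    (his : Irredundant s) (hit : Irredundant t) : Multiset.Rel Assoc s t := by
  induction s using Multiset.induction_on generalizing t with
  | empty =>
    rcases Multiset.empty_or_exists_mem t with rfl | ⟨y, hy⟩
    · exact .zero
    · obtain ⟨i, hi⟩ := ht y hy
      exact absurd (isUnit_of_dvd_one ((Multiset.dvd_prod hy).trans (by simpa using hst.2)))
        hi.isAtomElt.1
  | cons x s ih =>
    obtain ⟨i, hx⟩ := hs x (by simp)
    obtain ⟨y, hy, hxy⟩ := hx.exists_mem_dvd
      ((Multiset.dvd_prod (Multiset.mem_cons_self x s)).trans hst.1)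
    obtain ⟨t, rfl⟩ := Multiset.exists_cons_of_mem hy
    obtain ⟨j, hyj⟩ := ht y hy
    obtain rfl := hyj.eq_of_not_isUnit (j := i)
      fun hu => hx.not_isUnit (isUnit_of_dvd_unit (apply_dvd e hxy i) hu)
    have hassoc_i : Associated (e x i) (e y i) := by
      rcases hyj.1 with h0 | hp
      -- If `y` vanishes at `i`, it divides some `z` in `x ::ₘ s` that vanishes there too. Were `z`
      -- in `s`, it would absorb `x`, contradicting irredundancy.
      · obtain ⟨z, hz, hyz⟩ := hyj.exists_mem_dvd ((Multiset.dvd_prod hy).trans hst.2)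
        have hz0 : e z i = 0 := by
          have := apply_dvd e hyz i
          rwa [h0, zero_dvd_iff] at this
        rcases Multiset.mem_cons.1 hz with rfl | hz
        · rw [hz0, h0]
        · refine absurd (assoc_of_forall e fun k => ?_) (his x s rfl)
          by_cases hk : k = i
          · subst hk
            rw [apply_prod_eq_zero e (Multiset.mem_cons_of_mem hz) hz0,
              apply_prod_eq_zero e hz hz0]
          · rw [Multiset.prod_cons, map_mul, Pi.mul_apply]
            exact associated_unit_mul_left _ _ (hx.2 k hk)
      · have h1 := apply_dvd e hxy i
        have h2 : Prime (e x i) := hx.1.resolve_left fun h0 => hp.ne_zero (by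
          rwa [h0, zero_dvd_iff] at h1)
        exact h2.associated_of_dvd hp h1
    have hassoc : Assoc x y := assoc_of_forall e fun k => by
      by_cases hk : k = i
      · exact hk ▸ hassoc_i
      · exact (associated_one_iff_isUnit.2 (hx.2 k hk)).trans
          (associated_one_iff_isUnit.2 (hyj.2 k hk)).symm
    refine .cons hassoc (ih (fun z hz => hs z (Multiset.mem_cons_of_mem hz))
      (fun z hz => ht z (Multiset.mem_cons_of_mem hz)) (assoc_of_forall e fun k => ?_)
      his.of_cons hit.of_cons)
    have hk' := hst.apply (e := e) k
    simp only [Multiset.prod_cons, map_mul, Pi.mul_apply] at hk'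
    -- A nonzero coordinate can be cancelled. At a zero coordinate cancellation fails, but
    -- irredundancy makes both remaining products units there.
    by_cases hk0 : e x k = 0
    · obtain rfl := hx.eq_of_not_isUnit (j := k) (by simp [hk0])
      have hy0 : e y k = 0 := hassoc_i.eq_zero_iff.1 hk0
      exact (associated_one_iff_isUnit.2 (isUnit_apply_of_irredundant hs his hk0)).trans
        (associated_one_iff_isUnit.2 (isUnit_apply_of_irredundant ht hit hy0)).symm
    · exact hk'.of_mul_left (hassoc.apply k) hk0

variable [∀ i, UniqueFactorizationMonoid (E i)]

theorem IsAtomElt.exists_isPrimeAt (e : S ≃+* ∀ i, E i) {a : S} (h : IsAtomElt a) :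
    ∃ i, IsPrimeAt e i a := by
  classical
  obtain ⟨i, hi⟩ : ∃ i, ¬ IsUnit (e a i) := by
    by_contra! hc
    exact h.1 ((isUnit_iff_forall e).2 hc)
  have hother : ∀ j ≠ i, IsUnit (e a j) := by
    -- Separating the `i`-th coordinate from the others factors `a`; being an atom, `a` is associate
    -- to one of the two pieces, and the nonunit `e a i` rules out the second.
    have hab : a = e.symm (Function.update 1 i (e a i)) * e.symm (Function.update (e a) i 1) := by
      refine e.injective (funext fun j => ?_)
      by_cases hj : j = i
      · subst hj; simp
      · simp [hj]
    rcases h.2 _ _ hab with h1 | h1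
    · intro j hj
      have := h1.apply (e := e) j
      simpa [hj, associated_one_iff_isUnit] using this
    · have := h1.apply (e := e) i
      exact absurd (by simpa [associated_one_iff_isUnit] using this) hi
  refine ⟨i, ?_, hother⟩
  by_cases h0 : e a i = 0
  · exact .inl h0
  right
  refine Irreducible.prime ⟨hi, fun {x y} hxy => ?_⟩
  have hab : a = e.symm (Function.update 1 i x) * e.symm (Function.update (e a) i y) := by
    refine e.injective (funext fun j => ?_)
    by_cases hj : j = i
    · subst hj; simp [hxy]
    · simp [hj]
  rcases h.2 _ _ hab with h1 | h1
  · have h2 : Associated (x * y) (x * 1) := by simpa [hxy] using h1.apply (e := e) i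
    rw [hxy] at h0
    exact .inr (associated_one_iff_isUnit.1 (h2.of_mul_left (.refl x) (left_ne_zero_of_mul h0)))
  · have h2 : Associated (y * x) (y * 1) := by
      simpa [hxy, mul_comm] using h1.apply (e := e) i
    rw [hxy] at h0
    exact .inl (associated_one_iff_isUnit.1 (h2.of_mul_left (.refl y) (right_ne_zero_of_mul h0)))

theorem IsAtomElt.unit_mul (e : S ≃+* ∀ i, E i) {a : S} (h : IsAtomElt a) (w : Sˣ) : IsAtomElt
    (w * a) := by
  obtain ⟨i, hi⟩ := h.exists_isPrimeAt e
  have hw : ∀ j, IsUnit (e w j) := (isUnit_iff_forall e).1 w.isUnit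
  refine IsPrimeAt.isAtomElt (e := e) (i := i) ⟨?_, fun j hj => ?_⟩
  · rw [map_mul, Pi.mul_apply]
    refine hi.1.imp (fun h => by simp [h]) fun h => ?_
    exact (associated_unit_mul_left _ _ (hw i)).symm.prime h
  · rw [map_mul, Pi.mul_apply]
    exact (hw j).mul (hi.2 j hj)

/-- An element is the product of its coordinates, each extended by `1`. A zero coordinate gives an
atom as it stands, and a nonzero one is lifted from its prime factorization. -/
theorem exists_unit_mul_prod [Finite ι] (e : S ≃+* ∀ i, E i) (a : S) :
    ∃ (w : Sˣ) (s : Multiset S), (∀ x ∈ s, IsAtomElt x) ∧ a = w * s.prod := by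
  classical
  have := Fintype.ofFinite ι
  let Q : S → Prop := fun a =>
    ∃ (w : Sˣ) (s : Multiset S), (∀ x ∈ s, IsAtomElt x) ∧ a = w * s.prod
  have hmul : ∀ a b, Q a → Q b → Q (a * b) := by
    rintro _ _ ⟨w, s, hs, rfl⟩ ⟨w', s', hs', rfl⟩
    refine ⟨w * w', s + s', fun x hx => (Multiset.mem_add.1 hx).elim (hs x) (hs' x), ?_⟩
    rw [Multiset.prod_add, Units.val_mul]
    ring
  have hone : Q 1 := ⟨1, 0, by simp, by simp⟩
  let m : ∀ i, E i →* S := fun i => e.symm.toMonoidHom.comp (MonoidHom.mulSingle E i)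
  have hm : ∀ i x, e (m i x) = Pi.mulSingle i x := fun i x => e.apply_symm_apply _
  have hprime : ∀ i x, (x = 0 ∨ Prime x) → IsAtomElt (m i x) := by
    intro i x hx
    refine IsPrimeAt.isAtomElt (e := e) (i := i) ⟨?_, fun j hj => ?_⟩
    · rwa [hm, Pi.mulSingle_eq_same]
    · rw [hm, Pi.mulSingle_eq_of_ne hj]; exact isUnit_one
  have hsingle : ∀ i x, Q (m i x) := by
    intro i x
    by_cases hx : x = 0
    · exact ⟨1, {m i x}, by simpa using hprime i x (.inl hx), by simp⟩
    · obtain ⟨f, hf, w, hw⟩ := UniqueFactorizationMonoid.exists_prime_factors x hx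
      refine ⟨Units.map (m i) w, f.map (m i), ?_, ?_⟩
      · intro y hy
        obtain ⟨z, hz, rfl⟩ := Multiset.mem_map.1 hy
        exact hprime i z (.inr (hf z hz))
      · rw [← map_multiset_prod, Units.coe_map, ← map_mul, mul_comm, hw]
  have ha : a = ∏ i, m i (e a i) := by
    apply e.injective
    rw [map_prod]
    simp only [hm]
    exact (Finset.univ_prod_mulSingle _).symm
  rw [ha]
  exact Finset.prod_induction _ Q hmul hone fun i _ => hsingle i _

theorem exists_isFactorization_of_pi [Finite ι] (e : S ≃+* ∀ i, E i) (a : S) (ha : ¬ IsUnit a) :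
    ∃ s : Multiset S, IsFactorization IsAtomElt a s := by
  obtain ⟨w, s, hs, rfl⟩ := exists_unit_mul_prod e a
  rcases Multiset.empty_or_exists_mem s with rfl | ⟨x, hx⟩
  · exact absurd (by simp) ha
  · obtain ⟨s, rfl⟩ := Multiset.exists_cons_of_mem hx
    refine ⟨(w * x) ::ₘ s, ?_, by simp [mul_assoc]⟩
    intro y hy
    rcases Multiset.mem_cons.1 hy with rfl | hy
    · exact (hs x (by simp)).unit_mul e w
    · exact hs y (Multiset.mem_cons_of_mem hy)

theorem isAtomicRing_of_pi [Finite ι] (e : S ≃+* ∀ i, E i) : IsAtomicRing S :=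
    fun a _ hu => exists_isFactorization_of_pi e a hu

theorem isomorphicVia_of_irredundant (e : S ≃+* ∀ i, E i) {s t : Multiset S}
    (hs : ∀ x ∈ s, IsAtomElt x)
    (ht : ∀ x ∈ t, IsAtomElt x) (hst : Assoc s.prod t.prod)
    (his : Irredundant s) (hit : Irredundant t) : IsomorphicVia Assoc s t :=
  rel_assoc_of_irredundant (e := e) (fun x hx => (hs x hx).exists_isPrimeAt e)
    (fun x hx => (ht x hx).exists_isPrimeAt e) hst his hit

theorem isFactorialRing_of_pi [Finite ι] (e : S ≃+* ∀ i, E i) : IsFactorialRing S := by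
  refine ⟨fun a _ hu => exists_isFactorization_of_pi e a hu, fun a ha _ s t hs ht => ?_⟩
  refine isomorphicVia_of_irredundant e hs.1 ht.1 (by rw [← hs.2, ← ht.2]; exact .refl a) ?_ ?_
  · exact irredundant_of_mem_nonZeroDivisors hs.1 (hs.2 ▸ ha)
  · exact irredundant_of_mem_nonZeroDivisors ht.1 (ht.2 ▸ ha)

theorem isWeakUFR_of_pi [Finite ι] (e : S ≃+* ∀ i, E i) : IsWeakUFR S := by
  refine ⟨isAtomicRing_of_pi e, fun a _ _ s t hs ht => ⟨fun x hx => ?_, fun x hx => ?_⟩⟩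
  · obtain ⟨i, hi⟩ := (hs.1 x hx).exists_isPrimeAt e
    exact hi.exists_mem_dvd (ht.2 ▸ hs.2 ▸ Multiset.dvd_prod hx)
  · obtain ⟨i, hi⟩ := (ht.1 x hx).exists_isPrimeAt e
    exact hi.exists_mem_dvd (hs.2 ▸ ht.2 ▸ Multiset.dvd_prod hx)

theorem isFletcherUFR_of_pi [Finite ι] (e : S ≃+* ∀ i, E i) : IsFletcherUFR S := by
  refine ⟨fun a hu => ?_, fun a _ p q p' q' h h' => ?_⟩
  · obtain ⟨s, hs⟩ := exists_isFactorization_of_pi e a hu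
    exact exists_isUDecomposition hs
  · exact isomorphicVia_of_irredundant e h.2.1 h'.2.1 (h.assoc.symm.trans h'.assoc)
      h.irredundant h'.irredundant

theorem isMuReducedUFR_of_pi [Finite ι] (e : S ≃+* ∀ i, E i) : IsMuReducedUFR S := by
  refine ⟨isAtomicRing_of_pi e, fun a _ l₁ l₂ s t hs hsa his ht hta hit => ?_⟩
  exact isomorphicVia_of_irredundant e hs ht
    ((assoc_unit_mul l₁ _).symm.trans (hsa ▸ hta ▸ assoc_unit_mul l₂ _))
    (his.irredundant e) (hit.irredundant e)

end Product

/-! ### Unique factorization domains -/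

section Domain

variable {S : Type*} [CommRing S] [IsDomain S]

theorem isReducedUFR_of_isDomain [UniqueFactorizationMonoid S] : IsReducedUFR S := by
  have h := isMuReducedUFR_of_pi (RingEquiv.piUnique fun _ : Unit => S).symm
  have hred : ∀ (l : Sˣ) (s : Multiset S), (∀ x ∈ s, IsAtomElt x) → IsReducedFact l s →
      IsMuReducedFact l s := by
    rintro l s hs hr x t rfl l' heq
    have hx := hs x (by simp)
    rw [Multiset.prod_cons] at heq
    -- Zero is an atom here, so the remaining product may vanish; then omitting `x` changes nothing
    -- even with the same unit.
    by_cases ht : t.prod = 0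
    · exact hr x t rfl (by simp [ht])
    · refine hx.1 (isUnit_of_mul_dvd_of_mem_nonZeroDivisors
        (mem_nonZeroDivisors_of_ne_zero ht) ?_)
      have h2 : x * t.prod ∣ (l' : S) * t.prod := ⟨l, by rw [← heq, mul_comm]⟩
      exact h2.trans ((l'.isUnit.mul_left_dvd).2 dvd_rfl)
  exact ⟨h.1, fun a hu l₁ l₂ s t hs hsa hQs ht hta hQt =>
    h.2 a hu l₁ l₂ s t hs hsa (hred _ _ hs hQs) ht hta (hred _ _ ht hQt)⟩

theorem IsFactorization.irreducible_of_isDomain {α : AtomType} {a : S} (ha : a ≠ 0)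
    {s : Multiset S} (h : IsFactorization (α.IsIrred S) a s) : ∀ x ∈ s, Irreducible x :=
  h.irreducible (fun _ => AtomType.IsIrred.isAtomElt) (mem_nonZeroDivisors_of_ne_zero ha)

theorem isUFROfType_of_isDomain [UniqueFactorizationMonoid S] (α : AtomType) (β : IsoType) :
    IsUFROfType S α β := by
  refine ⟨fun a ha hu => ?_, fun a ha hu s t hs ht => ?_⟩
  · obtain ⟨f, hf, rfl, -⟩ := (WfDvdMonoid.not_isUnit_iff_exists_factors_eq a ha).1 hu
    exact ⟨f, fun x hx => α.isIrred_of_irreducible (hf x hx), rfl⟩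
  · have hs' := hs.irreducible_of_isDomain ha
    refine (UniqueFactorizationMonoid.factors_unique hs' (ht.irreducible_of_isDomain ha)
      (by exact .of_eq (hs.2.symm.trans ht.2))).mono fun x hx y hy hxy => ?_
    have hv : VeryStrongAssoc x y := by
      refine ⟨⟨hxy.dvd, hxy.symm.dvd⟩, .inr ⟨(hs' x hx).ne_zero, fun r hr => ?_⟩⟩
      refine ((hs' x hx).isUnit_or_isUnit hr).resolve_right fun hyu => ?_
      exact (hs' x hx).not_isUnit (hxy.symm.isUnit hyu)
    cases β with
    | isomorphic => exact hv.1
    | stronglyIsomorphic => exact hv.strongAssoc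
    | veryStronglyIsomorphic => exact hv

theorem isHomomorphicAtomic_of_isDomain [UniqueFactorizationMonoid S] :
    IsHomomorphicAtomic S := by
  have h := isUFROfType_of_isDomain (S := S) .atomic .isomorphic
  refine ⟨h.1, fun a ha hu s t hs ht => ⟨fun x hx => ?_, fun x hx => ?_⟩⟩
  · exact Multiset.exists_mem_of_rel_of_mem (h.2 a ha hu s t hs ht) hx
  · exact Multiset.exists_mem_of_rel_of_mem (h.2 a ha hu t s ht hs) hx

end Domain

/-! ### Obstructions from a second coordinate -/

section SeveralFactors

variable {ι : Type*} {E : ι → Type*} [∀ i, CommRing (E i)] [∀ i, IsDomain (E i)]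
  {S : Type*} [CommRing S] {i j : ι}

/-- With two coordinates there is an idempotent `p` that is neither zero nor a unit; a factorization
of `p` and its double have different lengths. -/
theorem subsingleton_of_isUFROfType (e : S ≃+* ∀ i, E i) {α : AtomType} {β : IsoType}
    (h : IsUFROfType S α β) : Subsingleton ι := by
  classical
  refine ⟨fun i j => by_contra fun hij => ?_⟩
  let p : S := e.symm (Function.update (1 : ∀ k, E k) j 0)
  have hp : e p = Function.update (1 : ∀ k, E k) j 0 := e.apply_symm_apply _
  have hp0 : p ≠ 0 := by
    intro h0
    have := congrFun hp i
    simp [h0, hij] at this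
  have hpu : ¬ IsUnit p := fun hu => by
    have := (isUnit_iff_forall e).1 hu j
    simp [hp] at this
  have hpp : p * p = p := by
    refine e.injective (funext fun k => ?_)
    by_cases hk : k = j
    · subst hk; simp [hp]
    · simp [hp, hk]
  obtain ⟨s, hs⟩ := h.1 p hp0 hpu
  have hss : IsFactorization (α.IsIrred S) p (s + s) :=
    ⟨fun x hx => (Multiset.mem_add.1 hx).elim (hs.1 x) (hs.1 x), by
      rw [Multiset.prod_add, ← hs.2, hpp]⟩
  have hcard := Multiset.card_eq_card_of_rel (h.2 p hp0 hpu _ _ hs hss)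
  rw [Multiset.card_add] at hcard
  have : s = 0 := Multiset.card_eq_zero.1 (by omega)
  exact hpu (by rw [hs.2, this]; simp)

/-- The atom `p` vanishing at `j` absorbs the atom `g` that is prime at `j`, so `p = p * g`; but `g`
is not associate to `p`. -/
theorem subsingleton_of_isHomomorphicAtomic (e : S ≃+* ∀ i, E i)
    (hE : ∀ i, ∃ x : E i, Prime x) (h : IsHomomorphicAtomic S) : Subsingleton ι := by
  classical
  refine ⟨fun i j => by_contra fun hij => ?_⟩
  obtain ⟨x, hx⟩ := hE j
  let p : S := e.symm (Function.update (1 : ∀ k, E k) j 0)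
  let g : S := e.symm (Function.update (1 : ∀ k, E k) j x)
  have hp : e p = Function.update (1 : ∀ k, E k) j 0 := e.apply_symm_apply _
  have hg : e g = Function.update (1 : ∀ k, E k) j x := e.apply_symm_apply _
  have hpa : IsAtomElt p := IsPrimeAt.isAtomElt (e := e) (i := j)
    ⟨by simp [hp], fun k hk => by simp [hp, hk]⟩
  have hga : IsAtomElt g := IsPrimeAt.isAtomElt (e := e) (i := j)
    ⟨by simp [hg, hx], fun k hk => by simp [hg, hk]⟩
  have hp0 : p ≠ 0 := by
    intro h0
    have := congrFun hp i
    simp [h0, hij] at this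
  have hpg : p = p * g := by
    refine e.injective (funext fun k => ?_)
    by_cases hk : k = j
    · subst hk; simp [hp, hg]
    · simp [hp, hg, hk]
  obtain ⟨y, hy, hgy⟩ := (h.2 p hp0 hpa.1 {p} {p, g} ⟨by simpa using hpa, by simp⟩
    ⟨by simpa using ⟨hpa, hga⟩, by simpa using hpg⟩).2 g (by simp)
  rw [Multiset.mem_singleton.1 hy] at hgy
  have := hgy.apply (e := e) j
  simp [hp, hg, hx.ne_zero] at this

/-- Let `p` vanish at `j`, and let `g` be prime at `j` and `w` at `i`. Then `p * g = l * p` for the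
unit `l` with entry `w` at `i`. If `w ≠ 1`, both sides are strongly reduced, of lengths two and one.
-/
theorem units_eq_one_of_isWeakStronglyReducedUFR (e : S ≃+* ∀ i, E i)
    (hE : ∀ i, ∃ x : E i, Prime x) (h : IsWeakStronglyReducedUFR S) (hij : i ≠ j)
    (w : (E i)ˣ) : w = 1 := by
  classical
  by_contra hw
  have hw' : (w : E i) ≠ 1 := fun h => hw (Units.ext h)
  obtain ⟨x, hx⟩ := hE j
  let p : S := e.symm (Function.update (1 : ∀ k, E k) j 0)
  let g : S := e.symm (Function.update (Function.update (1 : ∀ k, E k) i w) j x)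
  let l : Sˣ := Units.map e.symm.toMonoidHom (MulEquiv.piUnits.symm (Function.update 1 i w))
  have hp : e p = Function.update (1 : ∀ k, E k) j 0 := e.apply_symm_apply _
  have hg : e g = Function.update (Function.update (1 : ∀ k, E k) i w) j x := e.apply_symm_apply _
  have hl : ∀ k, e l k = (Function.update 1 i w : ∀ i, (E i)ˣ) k := by
    intro k
    simp [l]
  have hgu : ∀ k, k ≠ j → IsUnit (e g k) := by
    intro k hk
    by_cases hki : k = i
    · subst hki; simp [hg, hk]
    · simp [hg, hk, hki]
  have hpa : IsAtomElt p := IsPrimeAt.isAtomElt (e := e) (i := j)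
    ⟨by simp [hp], fun k hk => by simp [hp, hk]⟩
  have hga : IsAtomElt g := IsPrimeAt.isAtomElt (e := e) (i := j)
    ⟨by simp [hg, hx], hgu⟩
  have heq : p * g = l * p := by
    refine e.injective (funext fun k => ?_)
    rw [map_mul, map_mul, Pi.mul_apply, Pi.mul_apply, hl, hp, hg]
    by_cases hk : k = j
    · subst hk; simp
    · by_cases hki : k = i
      · subst hki; simp [hk]
      · simp [hk, hki]
  have hne : ∀ {a b : S} (k : ι), e a k ≠ e b k → a ≠ b := fun k hk h => hk (by rw [h])
  have ha0 : p * g ≠ 0 := hne i (by simp [hp, hg, hij])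
  have hau : ¬ IsUnit (p * g) := fun hu => hpa.1 (isUnit_of_mul_isUnit_left hu)
  have hst := h.2 (p * g) ha0 hau 1 l {p, g} {p} (by simpa using ⟨hpa, hga⟩) (by simp)
    (by
      intro t ht
      have hmem : t ∈ (p ::ₘ g ::ₘ 0).powerset := Multiset.mem_powerset.2 ht.le
      simp only [Multiset.powerset_cons, Multiset.powerset_zero, Multiset.map_singleton,
        Multiset.map_add, Multiset.mem_add, Multiset.mem_singleton] at hmem
      simp only [Multiset.insert_eq_cons, Multiset.prod_cons, Multiset.prod_singleton,
        Units.val_one, one_mul]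
      -- The submultisets appear in the order empty, `{g}`, `{p}`, and the whole; omitting only `g`
      -- is detected at `i`, where `w ≠ 1`.
      rcases hmem with (rfl | rfl) | (rfl | rfl)
      · exact hne j (by simp [hp])
      · exact hne j (by simp [hp, hg, hx.ne_zero.symm])
      · exact hne i (by simp [hp, hg, hij, hw'])
      · exact absurd ht (lt_irrefl _))
    (by simpa using hpa) (by simpa using heq)
    (by
      intro t ht
      have : t = 0 := by
        have := Multiset.card_lt_card ht
        exact Multiset.card_eq_zero.1 (by simpa using this)
      subst this
      exact hne j (by simp [hp, hl, hij.symm]))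
  simpa using Multiset.card_eq_card_of_rel hst

end SeveralFactors

/-! ### Assembling the equivalences for polynomial rings -/

section PolynomialRings

/-- Polynomial rings over a finite product of rings. -/
noncomputable def mvPolynomialPiEquiv {ι : Type*} [Finite ι] (Λ : Type*) (D : ι → Type*)
    [∀ i, CommRing (D i)] : MvPolynomial Λ (∀ i, D i) ≃+* ∀ i, MvPolynomial Λ (D i) := by
  classical
  refine RingEquiv.ofBijective (RingHom.pi fun i => MvPolynomial.map (Pi.evalRingHom D i))
    ⟨fun p q h => ?_, fun p => ?_⟩
  · ext m i
    have := congrArg (MvPolynomial.coeff m) (congrFun h i)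
    simpa [MvPolynomial.coeff_map] using this
  · have := Fintype.ofFinite ι
    choose q hq using fun i =>
      MvPolynomial.map_surjective (σ := Λ) (Pi.evalRingHom D i) (Function.surjective_eval i) (p i)
    refine ⟨∑ i, MvPolynomial.C (Pi.single i 1) * q i, funext fun j => ?_⟩
    simp only [RingHom.pi_apply, map_sum, map_mul, MvPolynomial.map_C, Pi.evalRingHom_apply]
    rw [Finset.sum_eq_single j]
    · simp [hq]
    · intro i _ hij
      simp [Pi.single_eq_of_ne hij.symm]
    · simp

theorem IsUFD.of_ringEquiv {A B : Type*} [CommRing A] [CommRing B] (h : IsUFD A) (f : A ≃+* B) :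
    IsUFD B := by
  obtain ⟨_, h2⟩ := h
  exact ⟨MulEquiv.isDomain A f.symm.toMulEquiv, f.toMulEquiv.uniqueFactorizationMonoid h2⟩

theorem IsUFD.mvPolynomial {A : Type*} [CommRing A] (h : IsUFD A) (Λ : Type*) :
    IsUFD (MvPolynomial Λ A) := by
  obtain ⟨_, _⟩ := h
  exact ⟨inferInstance, inferInstance⟩

theorem isUFD_of_subsingleton {R : Type*} [CommRing R] [Nontrivial R] {ι : Type*} [Subsingleton ι]
    {D : ι → Type*} [∀ i, CommRing (D i)] (hD : ∀ i, IsUFD (D i)) (f : R ≃+* ∀ i, D i) :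
    IsUFD R := by
  rcases isEmpty_or_nonempty ι with _ | ⟨⟨i⟩⟩
  · exact absurd f.injective.subsingleton (not_subsingleton R)
  · have := uniqueOfSubsingleton i
    exact (hD _).of_ringEquiv (f.trans (RingEquiv.piUnique D)).symm

variable {R : Type u} [CommRing R] [Nontrivial R] {Λ : Type v} [Nonempty Λ]
  {S : Type w} [CommRing S] {P : Prop}

theorem isFiniteProductOfUFDs_iff (g : S ≃+* MvPolynomial Λ R)
    (h₁ : P → HasRegularFactorization S)
    (h₂ : ∀ (n : ℕ) (E : Fin n → Type (max u v)) [∀ i, CommRing (E i)] [∀ i, IsDomain (E i)]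
      [∀ i, UniqueFactorizationMonoid (E i)], (S ≃+* ∀ i, E i) → P) :
    IsFiniteProductOfUFDs R ↔ P := by
  refine ⟨?_, fun h => ((h₁ h).of_ringEquiv g).isFiniteProductOfUFDs⟩
  rintro ⟨n, D, _, hD, ⟨f⟩⟩
  have _ := fun i => (hD i).1
  have _ := fun i => (hD i).2
  exact h₂ n (fun i => MvPolynomial Λ (D i))
    (g.trans ((MvPolynomial.mapEquiv Λ f).trans (mvPolynomialPiEquiv Λ D)))

/-- `S` serves for both kinds of polynomial ring. The primes granted to `h₃` are indeterminates,
present even when a coefficient ring is a field. -/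
theorem isUFD_iff (g : S ≃+* MvPolynomial Λ R)
    (h₁ : P → HasRegularFactorization S)
    (h₂ : ∀ [IsDomain S] [UniqueFactorizationMonoid S], P)
    (h₃ : ∀ (n : ℕ) (E : Fin n → Type (max u v)) [∀ i, CommRing (E i)] [∀ i, IsDomain (E i)],
      (S ≃+* ∀ i, E i) → (∀ i, ∃ x : E i, Prime x) → P → Subsingleton (Fin n)) :
    IsUFD R ↔ P := by
  refine ⟨fun h => ?_, fun h => ?_⟩
  · obtain ⟨_, _⟩ := (h.mvPolynomial Λ).of_ringEquiv g.symm
    exact h₂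
  · obtain ⟨n, D, _, hD, ⟨f⟩⟩ := ((h₁ h).of_ringEquiv g).isFiniteProductOfUFDs
    have _ := fun i => (hD i).1
    have := h₃ n (fun i => MvPolynomial Λ (D i))
      (g.trans ((MvPolynomial.mapEquiv Λ f).trans (mvPolynomialPiEquiv Λ D)))
      (fun i => ⟨_, MvPolynomial.X_prime (i := Classical.arbitrary Λ)⟩) h
    exact isUFD_of_subsingleton hD f

theorem isUFD_or_isFiniteProductOfUFDsWithTrivialUnits_iff (g : S ≃+* MvPolynomial Λ R)
    (h₁ : P → IsWeakStronglyReducedUFR S) (h₂ : IsReducedUFR S → P) :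
    IsUFD R ∨ IsFiniteProductOfUFDsWithTrivialUnits R ↔ P := by
  have : Nontrivial S := g.toEquiv.nontrivial
  refine ⟨?_, fun h => ?_⟩
  · rintro (h | ⟨n, D, _, hD, ⟨f⟩⟩)
    · obtain ⟨_, _⟩ := (h.mvPolynomial Λ).of_ringEquiv g.symm
      exact h₂ isReducedUFR_of_isDomain
    · have _ := fun i => (hD i).1.1
      have _ := fun i => (hD i).1.2
      let e := g.trans ((MvPolynomial.mapEquiv Λ f).trans (mvPolynomialPiEquiv Λ D))
      -- Units of a polynomial ring over a domain are constants, so the units stay trivial and being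
      -- reduced coincides with being `μ`-reduced.
      have hunit : ∀ l : Sˣ, (l : S) = 1 := by
        intro l
        refine e.injective (funext fun i => ?_)
        obtain ⟨r, hr, hlr⟩ := MvPolynomial.isUnit_iff_eq_C_of_isReduced.1
          ((isUnit_iff_forall e).1 l.isUnit i)
        have hr1 : r = 1 := by simpa using congrArg Units.val ((hD i).2 hr.unit)
        rw [hlr, hr1]
        simp
      refine h₂ ((isMuReducedUFR_of_pi e).mono ?_)
      rintro l s hr x t rfl l' heq
      exact hr x t rfl (by rw [heq, hunit l, hunit l'])
  · have hS := h₁ h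
    have hS' : IsWeakStronglyMuReducedUFR S :=
      HasWeakUniqueQFactorization.mono (fun _ _ => (·.isStronglyReducedFact)) hS
    obtain ⟨n, D, _, hD, ⟨f⟩⟩ :=
      (hS'.hasRegularFactorization.of_ringEquiv g).isFiniteProductOfUFDs
    have _ := fun i => (hD i).1
    rcases subsingleton_or_nontrivial (Fin n) with _ | _
    · exact .inl (isUFD_of_subsingleton hD f)
    · refine .inr ⟨n, D, _, fun i => ⟨hD i, fun w => ?_⟩, ⟨f⟩⟩
      obtain ⟨j, hj⟩ := exists_ne i
      have h1 := units_eq_one_of_isWeakStronglyReducedUFR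
        (g.trans ((MvPolynomial.mapEquiv Λ f).trans (mvPolynomialPiEquiv Λ D)))
        (fun i => ⟨_, MvPolynomial.X_prime (i := Classical.arbitrary Λ)⟩) hS hj.symm
        (Units.map MvPolynomial.C.toMonoidHom w)
      refine Units.ext (MvPolynomial.C_injective Λ (D i) ?_)
      simpa using congrArg Units.val h1

theorem isUFD_iff_isUFROfType (g : S ≃+* MvPolynomial Λ R) (α : AtomType) (β : IsoType) :
    IsUFD R ↔ IsUFROfType S α β := by
  have : Nontrivial S := g.toEquiv.nontrivial
  exact isUFD_iff g (·.hasRegularFactorization) (isUFROfType_of_isDomain α β)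
    fun _ _ _ _ e _ h => subsingleton_of_isUFROfType e h

theorem isUFD_iff_isUFR (g : S ≃+* MvPolynomial Λ R) : IsUFD R ↔ IsUFR S := by
  refine ⟨fun h => ⟨.atomic, .isomorphic, (isUFD_iff_isUFROfType g _ _).1 h⟩, ?_⟩
  rintro ⟨α, β, h⟩
  exact (isUFD_iff_isUFROfType g α β).2 h

theorem isUFD_iff_isHomomorphicAtomic (g : S ≃+* MvPolynomial Λ R) :
    IsUFD R ↔ IsHomomorphicAtomic S := by
  have : Nontrivial S := g.toEquiv.nontrivial
  exact isUFD_iff g (·.isWeakUFR.hasRegularFactorization) isHomomorphicAtomic_of_isDomain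
    fun _ _ _ _ e hE h => subsingleton_of_isHomomorphicAtomic e hE h

theorem isFiniteProductOfUFDs_iff_isFactorialRing (g : S ≃+* MvPolynomial Λ R) :
    IsFiniteProductOfUFDs R ↔ IsFactorialRing S :=
  isFiniteProductOfUFDs_iff g (·.hasRegularFactorization) fun _ _ _ _ _ => isFactorialRing_of_pi

theorem isFiniteProductOfUFDs_iff_isWeakUFR (g : S ≃+* MvPolynomial Λ R) :
    IsFiniteProductOfUFDs R ↔ IsWeakUFR S := by
  have : Nontrivial S := g.toEquiv.nontrivial
  exact isFiniteProductOfUFDs_iff g (·.hasRegularFactorization) fun _ _ _ _ _ => isWeakUFR_of_pi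

theorem isFiniteProductOfUFDs_iff_isFletcherUFR (g : S ≃+* MvPolynomial Λ R) :
    IsFiniteProductOfUFDs R ↔ IsFletcherUFR S :=
  isFiniteProductOfUFDs_iff g (·.hasRegularFactorization) fun _ _ _ _ _ => isFletcherUFR_of_pi

theorem isFiniteProductOfUFDs_iff_of_isMuReducedUFR (g : S ≃+* MvPolynomial Λ R)
    (h₁ : P → IsWeakStronglyMuReducedUFR S) (h₂ : IsMuReducedUFR S → P) :
    IsFiniteProductOfUFDs R ↔ P := by
  have : Nontrivial S := g.toEquiv.nontrivial
  exact isFiniteProductOfUFDs_iff g (fun h => (h₁ h).hasRegularFactorization)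
    fun _ _ _ _ _ e => h₂ (isMuReducedUFR_of_pi e)

theorem isFiniteProductOfUFDs_iff_isMuReducedUFR (g : S ≃+* MvPolynomial Λ R) :
    IsFiniteProductOfUFDs R ↔ IsMuReducedUFR S :=
  isFiniteProductOfUFDs_iff_of_isMuReducedUFR g
    (fun h => (HasUniqueQFactorization.mono (fun _ _ => (·.isMuReducedFact)) h).weak) id

theorem isFiniteProductOfUFDs_iff_isStronglyMuReducedUFR (g : S ≃+* MvPolynomial Λ R) :
    IsFiniteProductOfUFDs R ↔ IsStronglyMuReducedUFR S :=
  isFiniteProductOfUFDs_iff_of_isMuReducedUFR g HasUniqueQFactorization.weak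
    (HasUniqueQFactorization.mono fun _ _ => (·.isMuReducedFact))

theorem isFiniteProductOfUFDs_iff_isWeakMuReducedUFR (g : S ≃+* MvPolynomial Λ R) :
    IsFiniteProductOfUFDs R ↔ IsWeakMuReducedUFR S :=
  isFiniteProductOfUFDs_iff_of_isMuReducedUFR g
    (HasWeakUniqueQFactorization.mono fun _ _ => (·.isMuReducedFact)) HasUniqueQFactorization.weak

theorem isFiniteProductOfUFDs_iff_isWeakStronglyMuReducedUFR (g : S ≃+* MvPolynomial Λ R) :
    IsFiniteProductOfUFDs R ↔ IsWeakStronglyMuReducedUFR S :=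
  isFiniteProductOfUFDs_iff_of_isMuReducedUFR g id
    fun h => (HasUniqueQFactorization.mono (fun _ _ => (·.isMuReducedFact)) h).weak

theorem isUFD_or_iff_isReducedUFR (g : S ≃+* MvPolynomial Λ R) :
    IsUFD R ∨ IsFiniteProductOfUFDsWithTrivialUnits R ↔ IsReducedUFR S :=
  isUFD_or_isFiniteProductOfUFDsWithTrivialUnits_iff g
    (fun h => (HasUniqueQFactorization.mono (fun _ _ => (·.isReducedFact)) h).weak) id

theorem isUFD_or_iff_isStronglyReducedUFR (g : S ≃+* MvPolynomial Λ R) :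
    IsUFD R ∨ IsFiniteProductOfUFDsWithTrivialUnits R ↔ IsStronglyReducedUFR S :=
  isUFD_or_isFiniteProductOfUFDsWithTrivialUnits_iff g HasUniqueQFactorization.weak
    (HasUniqueQFactorization.mono fun _ _ => (·.isReducedFact))

theorem isUFD_or_iff_isWeakReducedUFR (g : S ≃+* MvPolynomial Λ R) :
    IsUFD R ∨ IsFiniteProductOfUFDsWithTrivialUnits R ↔ IsWeakReducedUFR S :=
  isUFD_or_isFiniteProductOfUFDsWithTrivialUnits_iff g
    (HasWeakUniqueQFactorization.mono fun _ _ => (·.isReducedFact)) HasUniqueQFactorization.weak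

theorem isUFD_or_iff_isWeakStronglyReducedUFR (g : S ≃+* MvPolynomial Λ R) :
    IsUFD R ∨ IsFiniteProductOfUFDsWithTrivialUnits R ↔ IsWeakStronglyReducedUFR S :=
  isUFD_or_isFiniteProductOfUFDsWithTrivialUnits_iff g id
    fun h => (HasUniqueQFactorization.mono (fun _ _ => (·.isReducedFact)) h).weak

end PolynomialRings

theorem fourEquiv_of_iff {A B : Prop} {C : Type v → Prop} (hB : A ↔ B)
    (hC : ∀ Λ : Type v, Nonempty Λ → (A ↔ C Λ)) : FourEquiv.{v} A B C := by
  unfold FourEquiv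
  tfae_have 1 ↔ 2 := hB
  tfae_have 1 → 3 := fun h Λ hΛ => (hC Λ hΛ).1 h
  tfae_have 3 → 4 := fun h => ⟨PUnit, inferInstance, h _ inferInstance⟩
  tfae_have 4 → 1 := fun ⟨Λ, hΛ, h⟩ => (hC Λ hΛ).2 h
  tfae_finish

end ZeroDivFactorization

theorem theorem5p8 (R : Type u) [CommRing R] [Nontrivial R] :
    -- (1) UFDs
    (FourEquiv.{v} (IsUFD R) (IsUFR R[X]) (fun Λ => IsUFR (MvPolynomial Λ R)) ∧
      (∀ (α : AtomType) (β : IsoType),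
        FourEquiv.{v} (IsUFD R) (IsUFROfType R[X] α β)
          (fun Λ => IsUFROfType (MvPolynomial Λ R) α β)) ∧
      FourEquiv.{v} (IsUFD R) (IsHomomorphicAtomic R[X])
        (fun Λ => IsHomomorphicAtomic (MvPolynomial Λ R))) ∧
    -- (2) finite direct products of UFDs
    (FourEquiv.{v} (IsFiniteProductOfUFDs R) (IsFactorialRing R[X])
        (fun Λ => IsFactorialRing (MvPolynomial Λ R)) ∧
      FourEquiv.{v} (IsFiniteProductOfUFDs R) (IsWeakUFR R[X])
        (fun Λ => IsWeakUFR (MvPolynomial Λ R)) ∧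
      FourEquiv.{v} (IsFiniteProductOfUFDs R) (IsFletcherUFR R[X])
        (fun Λ => IsFletcherUFR (MvPolynomial Λ R)) ∧
      FourEquiv.{v} (IsFiniteProductOfUFDs R) (IsMuReducedUFR R[X])
        (fun Λ => IsMuReducedUFR (MvPolynomial Λ R)) ∧
      FourEquiv.{v} (IsFiniteProductOfUFDs R) (IsStronglyMuReducedUFR R[X])
        (fun Λ => IsStronglyMuReducedUFR (MvPolynomial Λ R)) ∧
      FourEquiv.{v} (IsFiniteProductOfUFDs R) (IsWeakMuReducedUFR R[X])
        (fun Λ => IsWeakMuReducedUFR (MvPolynomial Λ R)) ∧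
      FourEquiv.{v} (IsFiniteProductOfUFDs R) (IsWeakStronglyMuReducedUFR R[X])
        (fun Λ => IsWeakStronglyMuReducedUFR (MvPolynomial Λ R))) ∧
    -- (3) UFDs, or finite direct products of UFDs with trivial unit groups
    (FourEquiv.{v} (IsUFD R ∨ IsFiniteProductOfUFDsWithTrivialUnits R) (IsReducedUFR R[X])
        (fun Λ => IsReducedUFR (MvPolynomial Λ R)) ∧
      FourEquiv.{v} (IsUFD R ∨ IsFiniteProductOfUFDsWithTrivialUnits R)
        (IsStronglyReducedUFR R[X])
        (fun Λ => IsStronglyReducedUFR (MvPolynomial Λ R)) ∧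
      FourEquiv.{v} (IsUFD R ∨ IsFiniteProductOfUFDsWithTrivialUnits R)
        (IsWeakReducedUFR R[X])
        (fun Λ => IsWeakReducedUFR (MvPolynomial Λ R)) ∧
      FourEquiv.{v} (IsUFD R ∨ IsFiniteProductOfUFDsWithTrivialUnits R)
        (IsWeakStronglyReducedUFR R[X])
        (fun Λ => IsWeakStronglyReducedUFR (MvPolynomial Λ R))) := by
  have g := (MvPolynomial.uniqueAlgEquiv R PUnit.{1}).symm.toRingEquiv
  have r := fun Λ : Type v => RingEquiv.refl (MvPolynomial Λ R)
  refine ⟨⟨?_, fun α β => ?_, ?_⟩, ⟨?_, ?_, ?_, ?_, ?_, ?_, ?_⟩, ⟨?_, ?_, ?_, ?_⟩⟩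
  · exact fourEquiv_of_iff (isUFD_iff_isUFR g) fun Λ _ =>
      isUFD_iff_isUFR (r Λ)
  · exact fourEquiv_of_iff (isUFD_iff_isUFROfType g α β) fun Λ _ =>
      isUFD_iff_isUFROfType (r Λ) α β
  · exact fourEquiv_of_iff (isUFD_iff_isHomomorphicAtomic g) fun Λ _ =>
      isUFD_iff_isHomomorphicAtomic (r Λ)
  · exact fourEquiv_of_iff (isFiniteProductOfUFDs_iff_isFactorialRing g) fun Λ _ =>
      isFiniteProductOfUFDs_iff_isFactorialRing (r Λ)
  · exact fourEquiv_of_iff (isFiniteProductOfUFDs_iff_isWeakUFR g) fun Λ _ =>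
      isFiniteProductOfUFDs_iff_isWeakUFR (r Λ)
  · exact fourEquiv_of_iff (isFiniteProductOfUFDs_iff_isFletcherUFR g) fun Λ _ =>
      isFiniteProductOfUFDs_iff_isFletcherUFR (r Λ)
  · exact fourEquiv_of_iff (isFiniteProductOfUFDs_iff_isMuReducedUFR g) fun Λ _ =>
      isFiniteProductOfUFDs_iff_isMuReducedUFR (r Λ)
  · exact fourEquiv_of_iff (isFiniteProductOfUFDs_iff_isStronglyMuReducedUFR g) fun Λ _ =>
      isFiniteProductOfUFDs_iff_isStronglyMuReducedUFR (r Λ)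
  · exact fourEquiv_of_iff (isFiniteProductOfUFDs_iff_isWeakMuReducedUFR g) fun Λ _ =>
      isFiniteProductOfUFDs_iff_isWeakMuReducedUFR (r Λ)
  · exact fourEquiv_of_iff (isFiniteProductOfUFDs_iff_isWeakStronglyMuReducedUFR g) fun Λ _ =>
      isFiniteProductOfUFDs_iff_isWeakStronglyMuReducedUFR (r Λ)
  · exact fourEquiv_of_iff (isUFD_or_iff_isReducedUFR g) fun Λ _ =>
      isUFD_or_iff_isReducedUFR (r Λ)
  · exact fourEquiv_of_iff (isUFD_or_iff_isStronglyReducedUFR g) fun Λ _ =>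
      isUFD_or_iff_isStronglyReducedUFR (r Λ)
  · exact fourEquiv_of_iff (isUFD_or_iff_isWeakReducedUFR g) fun Λ _ =>
      isUFD_or_iff_isWeakReducedUFR (r Λ)
  · exact fourEquiv_of_iff (isUFD_or_iff_isWeakStronglyReducedUFR g) fun Λ _ =>
      isUFD_or_iff_isWeakStronglyReducedUFR (r Λ)
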